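/- Let $\mathcal H^A,\mathcal H^B$ be finite-dimensional quantum systems and $D=\dim(\mathcal H^A\otimes\mathcal H^B)$. Let $\mathcal{QC}$ be the set of quantum-classical states $\sum_l p_l\,\rho_l^A\otimes|l\rangle\langle l|^B$, where $(p_l)$ is a probability distribution, the $\rho_l^A$ are states, and $(|l\rangle^B)$ is an arbitrary (not fixed) orthonormal basis of $\mathcal H^B$. Let $\mathcal{CQ}$ be the set obtained by interchanging the roles of $A$ and $B$. For $\mathcal F\in\{\mathcal{QC},\mathcal{CQ}\}$ and a state $\phi$ on $\mathcal H^A\otimes\mathcal H^B$ put $$D^{\mathcal F}_{\rm rel}(\phi)=\min_{\sigma\in\mathcal F}D(\phi\|\sigma),$$ where $D(\phi\|\sigma)=\mathrm{tr}(\phi\log_2\phi)-\mathrm{tr}(\phi\log_2\sigma)$ if $\mathrm{supp}\,\phi\subseteq\mathrm{supp}\,\sigma$, and $+\infty$ otherwise. Let $\|\cdot\|_1$ be the trace norm and $h_2(x)=-x\log_2x-(1-x)\log_2(1-x)$. Tensor powers of a bipartite system are again regarded as bipartite, $(\mathcal H^A)^{\otimes n}\otimes(\mathcal H^B)^{\otimes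 n}$. Theorem. Let $\mathcal F$ be $\mathcal{QC}$ or $\mathcal{CQ}$. (1) The minimum defining $D^{\mathcal F}_{\rm rel}(\phi)$ exists and is finite, and for all states $\phi,\psi$ on $\mathcal H^A\otimes\mathcal H^B$ $$|D^{\mathcal F}_{\rm rel}(\phi)-D^{\mathcal F}_{\rm rel}(\psi)|\le\|\phi-\psi\|_1\log_2D+2h_2\!\left(\tfrac12\|\phi-\psi\|_1\right).$$ In particular $D^{\mathcal F}_{\rm rel}$ is asymptotically continuous: if $n_i\ge1$ and $\phi_i,\psi_i$ are states on $(\mathcal H^A\otimes\mathcal H^B)^{\otimes n_i}$ with $\|\phi_i-\psi_i\|_1\to0$, then $|D^{\mathcal F}_{\rm rel}(\phi_i)-D^{\mathcal F}_{\rm rel}(\psi_i)|/n_i\to0$. (2) The regularization $D^{\mathcal F,\infty}_{\rm rel}(\phi)=\lim_{n\to\infty}D^{\mathcal F}_{\rm rel}(\phi^{\otimes n})/n$ exists for every state $\phi$, and it is a consistent measure in the following sense. Let $O$ be any class of free operations, that is, of completely positive trace-preserving linear maps between finite-dimensional bipartite systems that map states in $\mathcal F$ to states in $\mathcal F$. Then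 $D^{\mathcal F}_{\rm rel}$ does not increase under operations in $O$, and for all states $\phi,\psi$ of finite-dimensional bipartite systems $$D^{\mathcal F,\infty}_{\rm rel}(\psi)\,r(\phi\to\psi)\le D^{\mathcal F,\infty}_{\rm rel}(\phi)\qquad(0\cdot\infty=0),$$ where $r(\phi\to\psi)\in[0,\infty]$ is the supremum of all $r\ge0$ for which there are operations $\mathcal N_n\in O$ with $\liminf_{n\to\infty}\|\mathcal N_n(\phi^{\otimes n})-\psi^{\otimes\lceil rn\rceil}\|_1=0$ (and $0$ if there is no such $r$). If moreover $\mathcal N^{\otimes n}\in O$ for all $\mathcal N\in O$ and all $n$, then $D^{\mathcal F,\infty}_{\rm rel}$ does not increase under operations in $O$ either. -/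

import Mathlib

open Filter Topology
open scoped Matrix Kronecker ENNReal NNReal ComplexOrder

noncomputable section

/-! ### States, entropic quantities and channels on finite-dimensional systems

A finite-dimensional system is given by a finite index type `ι` labelling an orthonormal basis;
operators on it are the matrices `Matrix ι ι ℂ`. -/

/-- Quantum states: positive semidefinite operators of trace one. -/
def IsState {ι : Type} [Fintype ι] (ρ : Matrix ι ι ℂ) : Prop :=
  ρ.PosSemidef ∧ ρ.trace = 1

/-- The operator logarithm to base two of a positive semidefinite operator. It vanishes on the
kernel (`Real.logb 2 0 = 0`), that is, the logarithm is taken on the support. -/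
def opLog {ι : Type} [Fintype ι] [DecidableEq ι] (ρ : Matrix ι ι ℂ) : Matrix ι ι ℂ :=
  cfc (Real.logb 2) ρ

/-- The quantum relative entropy `D(φ‖ψ)`: it is `tr (φ log₂ φ) - tr (φ log₂ ψ)` if the support
(the range) of `φ` is contained in that of `ψ`, and `+∞` otherwise. -/
def relEntropy {ι : Type} [Fintype ι] [DecidableEq ι] (φ ψ : Matrix ι ι ℂ) : EReal :=
  open Classical in
  if LinearMap.range φ.mulVecLin ≤ LinearMap.range ψ.mulVecLin then
    (((φ * opLog φ).trace.re - (φ * opLog ψ).trace.re : ℝ) : EReal)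
  else ⊤

/-- The trace norm `‖X‖₁ = tr √(X† X)`. -/
def traceNorm {ι : Type} [Fintype ι] [DecidableEq ι] (X : Matrix ι ι ℂ) : ℝ :=
  (cfc Real.sqrt (Xᴴ * X)).trace.re

/-- The binary entropy function, in bits. -/
def h₂ (x : ℝ) : ℝ := -x * Real.logb 2 x - (1 - x) * Real.logb 2 (1 - x)

/-- The ampliation `N ⊗ id` of `N` by a `k`-dimensional system. -/
def ampliation {ι κ : Type} (N : Matrix ι ι ℂ →ₗ[ℂ] Matrix κ κ ℂ) (k : ℕ)
    (X : Matrix (ι × Fin k) (ι × Fin k) ℂ) : Matrix (κ × Fin k) (κ × Fin k) ℂ :=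
  Matrix.of fun x y => N (Matrix.of fun i j => X (i, x.2) (j, y.2)) x.1 y.1

/-- Quantum operations: linear, completely positive and trace-preserving maps. -/
structure IsChannel {ι κ : Type} [Fintype ι] [Fintype κ]
    (N : Matrix ι ι ℂ →ₗ[ℂ] Matrix κ κ ℂ) : Prop where
  completely_positive : ∀ (k : ℕ) (X : Matrix (ι × Fin k) (ι × Fin k) ℂ),
    X.PosSemidef → (ampliation N k X).PosSemidef
  trace_preserving : ∀ X, (N X).trace = X.trace

/-! ### Bipartite systems and their tensor powers -/

/-- A finite-dimensional bipartite system `H^A ⊗ H^B`, with `H^A = ℂ^A` and `H^B = ℂ^B`. -/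
structure BipartiteSystem where
  A : Type
  B : Type
  [fintypeA : Fintype A]
  [decEqA : DecidableEq A]
  [fintypeB : Fintype B]
  [decEqB : DecidableEq B]

attribute [instance] BipartiteSystem.fintypeA BipartiteSystem.decEqA
  BipartiteSystem.fintypeB BipartiteSystem.decEqB

/-- The index type of a product basis of `H^A ⊗ H^B`. -/
abbrev BipartiteSystem.Idx (S : BipartiteSystem) : Type := S.A × S.B

/-- Operators on `H^A ⊗ H^B`. -/
abbrev Op (S : BipartiteSystem) : Type := Matrix S.Idx S.Idx ℂ

/-- The dimension of `H^A ⊗ H^B`. -/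
def BipartiteSystem.dim (S : BipartiteSystem) : ℕ := Fintype.card S.A * Fintype.card S.B

/-- The `n`-th tensor power, as the bipartite system `(H^A)^{⊗n} ⊗ (H^B)^{⊗n}`. -/
def BipartiteSystem.pow (S : BipartiteSystem) (n : ℕ) : BipartiteSystem where
  A := Fin n → S.A
  B := Fin n → S.B

/-- The tensor product `X₁ ⊗ ⋯ ⊗ Xₙ` of operators on `H^A ⊗ H^B`, as an operator on
`(H^A)^{⊗n} ⊗ (H^B)^{⊗n}`. -/
def tensorProd {S : BipartiteSystem} {n : ℕ} (X : Fin n → Op S) : Op (S.pow n) :=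
  Matrix.of fun (x y : (Fin n → S.A) × (Fin n → S.B)) =>
    ∏ i, X i (x.1 i, x.2 i) (y.1 i, y.2 i)

/-- The tensor power `φ^{⊗n}`. -/
def tensorPow {S : BipartiteSystem} (φ : Op S) (n : ℕ) : Op (S.pow n) :=
  tensorProd fun _ : Fin n => φ

/-- `L` is the tensor power `N^{⊗n}` of the linear map `N`. As products of operators span, this
determines `L`. -/
def IsTensorPowOf {S T : BipartiteSystem} (N : Op S →ₗ[ℂ] Op T) (n : ℕ)
    (L : Op (S.pow n) →ₗ[ℂ] Op (T.pow n)) : Prop :=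
  ∀ X : Fin n → Op S, L (tensorProd X) = tensorProd fun i => N (X i)

/-! ### States without discord -/

/-- A set of states for each bipartite system. -/
abbrev StateFamily : Type 1 := ∀ S : BipartiteSystem, Set (Op S)

/-- The rank-one projection `|v⟩⟨v|` onto a unit vector. -/
def ketbra {ι : Type} (v : EuclideanSpace ℂ ι) : Matrix ι ι ℂ :=
  Matrix.of fun i j => v i * star (v j)

/-- Quantum-classical states `∑ₖ pₖ ρₖ ⊗ |bₖ⟩⟨bₖ|`, with `(bₖ)` any orthonormal basis of `H^B`. -/
def QC : StateFamily := fun S =>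
  {ρ | ∃ (b : OrthonormalBasis S.B ℂ (EuclideanSpace ℂ S.B)) (p : S.B → ℝ)
      (τ : S.B → Matrix S.A S.A ℂ),
    (∀ k, 0 ≤ p k) ∧ ∑ k, p k = 1 ∧ (∀ k, IsState (τ k)) ∧
    ρ = ∑ k, (p k : ℂ) • (τ k ⊗ₖ ketbra (b k))}

/-- Classical-quantum states `∑ₖ pₖ |aₖ⟩⟨aₖ| ⊗ ρₖ`, with `(aₖ)` any orthonormal basis of `H^A`. -/
def CQ : StateFamily := fun S =>
  {ρ | ∃ (a : OrthonormalBasis S.A ℂ (EuclideanSpace ℂ S.A)) (p : S.A → ℝ)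
      (τ : S.A → Matrix S.B S.B ℂ),
    (∀ k, 0 ≤ p k) ∧ ∑ k, p k = 1 ∧ (∀ k, IsState (τ k)) ∧
    ρ = ∑ k, (p k : ℂ) • (ketbra (a k) ⊗ₖ τ k)}

/-! ### Measures and conversion rates -/

/-- A real function of the states (its values elsewhere are irrelevant) of each system. -/
abbrev MeasureFamily : Type 1 := ∀ S : BipartiteSystem, Op S → ℝ

/-- The relative entropy of discord, with respect to the set `F` of free states. -/
def relDiscord (F : StateFamily) : MeasureFamily := fun S φ =>
  (sInf (relEntropy φ '' F S)).toReal

/-- The regularization `R^∞(φ) = lim R(φ^{⊗n}) / n`. -/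
def regularization (R : MeasureFamily) : MeasureFamily := fun S φ =>
  limUnder atTop fun n : ℕ => R (S.pow n) (tensorPow φ n) / n

/-- A class of maps between the operators on bipartite systems. -/
abbrev OperationClass : Type 1 := ∀ S T : BipartiteSystem, Set (Op S →ₗ[ℂ] Op T)

/-- All members of `O` are quantum operations, and they map free states to free states. -/
def OperationClass.Preserves (O : OperationClass) (F : StateFamily) : Prop :=
  ∀ S T, ∀ N ∈ O S T, IsChannel N ∧ ∀ σ ∈ F S, N σ ∈ F T

/-- `N^{⊗n}` is in `O` for all `N` in `O`. -/
def OperationClass.ClosedUnderTensorPowers (O : OperationClass) : Prop :=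
  ∀ S T, ∀ N ∈ O S T, ∀ (n : ℕ) (L : Op (S.pow n) →ₗ[ℂ] Op (T.pow n)),
    IsTensorPowOf N n L → L ∈ O (S.pow n) (T.pow n)

/-- Monotonicity: `R` does not increase under the operations in `O`. -/
def IsMonotone (O : OperationClass) (R : MeasureFamily) : Prop :=
  ∀ S T, ∀ N ∈ O S T, ∀ φ : Op S, IsState φ → R T (N φ) ≤ R S φ

/-- Operations in `O` convert `φ` into `ψ` asymptotically at the rate `r`. -/
def IsAchievable (O : OperationClass) {S T : BipartiteSystem} (φ : Op S) (ψ : Op T)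
    (r : ℝ≥0) : Prop :=
  ∃ N : ∀ n : ℕ, Op (S.pow n) →ₗ[ℂ] Op (T.pow ⌈(r : ℝ) * n⌉₊),
    (∀ n, N n ∈ O (S.pow n) (T.pow ⌈(r : ℝ) * n⌉₊)) ∧
    liminf (fun n : ℕ =>
      traceNorm (N n (tensorPow φ n) - tensorPow ψ ⌈(r : ℝ) * n⌉₊)) atTop = 0

/-- The asymptotic conversion rate `r(φ → ψ)`, possibly infinite. -/
def conversionRate (O : OperationClass) {S T : BipartiteSystem} (φ : Op S) (ψ : Op T) : ℝ≥0∞ :=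
  ⨆ (r : ℝ≥0) (_ : IsAchievable O φ ψ r), (r : ℝ≥0∞)

/-- `R(ψ) r(φ → ψ) ≤ R(φ)` for all states `φ` and `ψ` (with `0 · ∞ = 0`). -/
def IsConsistent (O : OperationClass) (R : MeasureFamily) : Prop :=
  ∀ (S T : BipartiteSystem) (φ : Op S) (ψ : Op T), IsState φ → IsState ψ →
    ((R T ψ : ℝ) : EReal) * (conversionRate O φ ψ : EReal) ≤ ((R S φ : ℝ) : EReal)

/-- Asymptotic continuity of a measure. -/
def IsAsymptoticallyContinuous (R : MeasureFamily) : Prop :=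
  ∀ (S : BipartiteSystem) (n : ℕ → ℕ) (φ ψ : ∀ i, Op (S.pow (n i))),
    (∀ i, 0 < n i) → (∀ i, IsState (φ i)) → (∀ i, IsState (ψ i)) →
    Tendsto (fun i => traceNorm (φ i - ψ i)) atTop (𝓝 0) →
    Tendsto (fun i => |R (S.pow (n i)) (φ i) - R (S.pow (n i)) (ψ i)| / n i) atTop (𝓝 0)

end

/-! A quantum-classical state is the same as a state diagonal in some basis a_k(j) ⊗ b(k), where b
is an orthonormal basis of H^B and each a_k is one of H^A. These bases form a compact family closed
under tensor products; interchanging the parties gives the same for classical-quantum states.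
`IsBasisFamily` isolates this, and nothing else about the free states is used.

For a fixed basis U, Gibbs' inequality shows that the state closest to φ among those diagonal in U
is φ dephased in U, at distance H(diag_U φ) - S(φ). Hence the discord is the minimum over U of
H(diag_U φ) - S(φ), attained by compactness (`IsBasisFamily.exists_isLeast`). Three consequences
follow. Testing φ in the optimal basis of ψ and applying Fannes–Audenaert (`shannon_sub_le`) once to
the dephased states and once to the states themselves gives the continuity bound. Tensoring optimal
bases gives subadditivity on tensor powers, so the regularization exists by Fekete's lemma. The
discord is nonnegative because dephasing does not decrease entropy.

Monotonicity under free operations is data processing (`relEntropy_map_le`). In nats, D(φ‖σ) is a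
renormalized integral over T > 0 of a resolvent form. For each T this form is the supremum over Y of
a linear term minus two positive quadratic terms. Pulling Y back through the adjoint of the channel
preserves the linear term and, by Kadison–Schwarz, does not increase the quadratic ones, so the form
decreases under the channel.

Consistency (`IsBasisFamily.mul_regularization_le`) combines these: the discord of ψ^{⊗⌈rn⌉} is at
most that of φ^{⊗n}, up to an error whose quotient by n is small along the infinitely many n where
the conversion is accurate. -/

/-! ### Unitary diagonalization -/

section Diagonalization

variable {ι : Type} [Fintype ι] [DecidableEq ι]

/-- The Hermitian operator `U diag(s) U†`. -/
noncomputable def unitaryDiag (U : Matrix ι ι ℂ) (s : ι → ℝ) : Matrix ι ι ℂ :=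
  U * Matrix.diagonal (fun i => (s i : ℂ)) * Uᴴ

/-- The diagonal of `X` in the basis of the columns of `U`. -/
noncomputable def diagIn (U X : Matrix ι ι ℂ) (i : ι) : ℝ := ((Uᴴ * X * U) i i).re

theorem conjTranspose_mul_self_of_mem_unitaryGroup {U : Matrix ι ι ℂ}
    (hU : U ∈ Matrix.unitaryGroup ι ℂ) : Uᴴ * U = 1 :=
  Matrix.mem_unitaryGroup_iff'.1 hU

theorem mul_conjTranspose_self_of_mem_unitaryGroup {U : Matrix ι ι ℂ}
    (hU : U ∈ Matrix.unitaryGroup ι ℂ) : U * Uᴴ = 1 :=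
  Matrix.mem_unitaryGroup_iff.1 hU

theorem unitaryDiag_apply (U : Matrix ι ι ℂ) (s : ι → ℝ) (i j : ι) :
    unitaryDiag U s i j = ∑ k, U i k * s k * star (U j k) := by
  rw [unitaryDiag, Matrix.mul_apply]
  simp only [Matrix.mul_diagonal, Matrix.conjTranspose_apply]

theorem isHermitian_unitaryDiag (U : Matrix ι ι ℂ) (s : ι → ℝ) :
    (unitaryDiag U s).IsHermitian := by
  unfold unitaryDiag
  refine Matrix.isHermitian_mul_mul_conjTranspose _ ?_
  exact Matrix.isHermitian_diagonal_of_self_adjoint _ (by ext i; simp)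

theorem posSemidef_unitaryDiag (U : Matrix ι ι ℂ) {s : ι → ℝ} (hs : ∀ i, 0 ≤ s i) :
    (unitaryDiag U s).PosSemidef :=
  Matrix.PosSemidef.mul_mul_conjTranspose_same
    (Matrix.PosSemidef.diagonal fun i => by simpa using hs i) U

theorem exists_eq_unitaryDiag {X : Matrix ι ι ℂ} (hX : X.IsHermitian) :
    ∃ U ∈ Matrix.unitaryGroup ι ℂ, ∃ s : ι → ℝ, X = unitaryDiag U s := by
  refine ⟨hX.eigenvectorUnitary, hX.eigenvectorUnitary.2, hX.eigenvalues, ?_⟩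
  conv_lhs => rw [hX.spectral_theorem]
  rfl

theorem conj_unitaryDiag {U : Matrix ι ι ℂ} (hU : U ∈ Matrix.unitaryGroup ι ℂ) (s : ι → ℝ) :
    Uᴴ * unitaryDiag U s * U = Matrix.diagonal fun i => (s i : ℂ) := by
  have h := conjTranspose_mul_self_of_mem_unitaryGroup hU
  unfold unitaryDiag
  rw [Matrix.mul_assoc, Matrix.mul_assoc (U * _), h, Matrix.mul_one, ← Matrix.mul_assoc, h,
    Matrix.one_mul]

@[simp] theorem diagIn_unitaryDiag_self {U : Matrix ι ι ℂ} (hU : U ∈ Matrix.unitaryGroup ι ℂ)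
    (s : ι → ℝ) : diagIn U (unitaryDiag U s) = s := by
  ext i
  simp [diagIn, conj_unitaryDiag hU]

omit [DecidableEq ι] in
theorem diagIn_nonneg {X : Matrix ι ι ℂ} (hX : X.PosSemidef) (U : Matrix ι ι ℂ) (i : ι) :
    0 ≤ diagIn U X i :=
  (Complex.le_def.1 (hX.conjTranspose_mul_mul_same U).diag_nonneg).1

theorem sum_diagIn {U : Matrix ι ι ℂ} (hU : U ∈ Matrix.unitaryGroup ι ℂ) (X : Matrix ι ι ℂ) :
    ∑ i, diagIn U X i = X.trace.re := by
  have h : (Uᴴ * X * U).trace = X.trace := by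
    rw [Matrix.trace_mul_comm, ← Matrix.mul_assoc, mul_conjTranspose_self_of_mem_unitaryGroup hU,
      Matrix.one_mul]
  rw [← h, Matrix.trace, Complex.re_sum]
  rfl

theorem trace_unitaryDiag {U : Matrix ι ι ℂ} (hU : U ∈ Matrix.unitaryGroup ι ℂ) (s : ι → ℝ) :
    (unitaryDiag U s).trace = ((∑ i, s i : ℝ) : ℂ) := by
  unfold unitaryDiag
  rw [Matrix.trace_mul_comm, ← Matrix.mul_assoc, conjTranspose_mul_self_of_mem_unitaryGroup hU,
    Matrix.one_mul, Matrix.trace_diagonal]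
  simp

omit [DecidableEq ι] in
theorem diagIn_sub (U X Y : Matrix ι ι ℂ) (i : ι) :
    diagIn U (X - Y) i = diagIn U X i - diagIn U Y i := by
  simp [diagIn, Matrix.mul_sub, Matrix.sub_mul]

theorem trace_mul_unitaryDiag (U X : Matrix ι ι ℂ) (s : ι → ℝ) :
    (X * unitaryDiag U s).trace.re = ∑ i, diagIn U X i * s i := by
  have h : (X * unitaryDiag U s).trace =
      ((Uᴴ * X * U) * Matrix.diagonal fun i => (s i : ℂ)).trace := by
    unfold unitaryDiag
    rw [← Matrix.mul_assoc, Matrix.trace_mul_comm, ← Matrix.mul_assoc, ← Matrix.mul_assoc]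
  rw [h, Matrix.trace, Complex.re_sum]
  refine Finset.sum_congr rfl fun i _ => ?_
  simp [diagIn, Matrix.mul_diagonal]

/-- The weights are the overlaps |⟨u_i, v_j⟩|². For unitary U and V they form a doubly stochastic
matrix, which drives every comparison of two bases below. -/
theorem diagIn_unitaryDiag (U V : Matrix ι ι ℂ) (s : ι → ℝ) (i : ι) :
    diagIn U (unitaryDiag V s) i = ∑ j, Complex.normSq ((Uᴴ * V) i j) * s j := by
  have h : Uᴴ * unitaryDiag V s * U = unitaryDiag (Uᴴ * V) s := by
    simp [unitaryDiag, Matrix.mul_assoc, Matrix.conjTranspose_mul]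
  rw [diagIn, h, unitaryDiag_apply, Complex.re_sum]
  refine Finset.sum_congr rfl fun j _ => ?_
  rw [mul_right_comm, Complex.star_def, Complex.mul_conj, ← Complex.ofReal_mul, Complex.ofReal_re]

theorem sum_normSq_row {W : Matrix ι ι ℂ} (hW : W ∈ Matrix.unitaryGroup ι ℂ) (i : ι) :
    ∑ j, Complex.normSq (W i j) = 1 := by
  have h := congrFun (congrFun (mul_conjTranspose_self_of_mem_unitaryGroup hW) i) i
  rw [Matrix.mul_apply] at h
  simp only [Matrix.conjTranspose_apply, Complex.star_def, Complex.mul_conj,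
    Matrix.one_apply_eq] at h
  exact_mod_cast h

theorem sum_normSq_col {W : Matrix ι ι ℂ} (hW : W ∈ Matrix.unitaryGroup ι ℂ) (j : ι) :
    ∑ i, Complex.normSq (W i j) = 1 := by
  have h := sum_normSq_row (Unitary.star_mem hW) j
  simpa [Matrix.star_eq_conjTranspose, Complex.normSq_conj] using h

theorem conjTranspose_mul_mem_unitaryGroup {U V : Matrix ι ι ℂ}
    (hU : U ∈ Matrix.unitaryGroup ι ℂ) (hV : V ∈ Matrix.unitaryGroup ι ℂ) :
    Uᴴ * V ∈ Matrix.unitaryGroup ι ℂ :=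
  mul_mem (Unitary.star_mem hU) hV

theorem aeval_unitaryDiag {U : Matrix ι ι ℂ} (hU : U ∈ Matrix.unitaryGroup ι ℂ) (s : ι → ℝ)
    (q : Polynomial ℝ) :
    Polynomial.aeval (unitaryDiag U s) q = unitaryDiag U fun i => q.eval (s i) := by
  have h := conjTranspose_mul_self_of_mem_unitaryGroup hU
  have h' := mul_conjTranspose_self_of_mem_unitaryGroup hU
  induction q using Polynomial.induction_on' with
  | add p q hp hq =>
    rw [map_add, hp, hq]
    simp only [unitaryDiag, Polynomial.eval_add, Complex.ofReal_add]
    rw [← Matrix.diagonal_add, Matrix.mul_add, Matrix.add_mul]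
  | monomial n a =>
    have hpow : unitaryDiag U s ^ n = unitaryDiag U fun i => s i ^ n := by
      induction n with
      | zero => simp [unitaryDiag, h']
      | succ n ih =>
        rw [pow_succ, ih]
        simp only [unitaryDiag]
        rw [Matrix.mul_assoc, ← Matrix.mul_assoc Uᴴ, ← Matrix.mul_assoc Uᴴ, h, Matrix.one_mul,
          Matrix.mul_assoc, ← Matrix.mul_assoc (Matrix.diagonal _), Matrix.diagonal_mul_diagonal,
          ← Matrix.mul_assoc]
        simp [pow_succ]
    rw [Polynomial.aeval_monomial, hpow, ← Algebra.smul_def]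
    ext i j
    rw [Matrix.smul_apply, unitaryDiag_apply, unitaryDiag_apply, Finset.smul_sum]
    refine Finset.sum_congr rfl fun k _ => ?_
    rw [Polynomial.eval_monomial, Complex.real_smul]
    push_cast
    ring

/-- On a finite spectrum every function agrees with an interpolating polynomial, and for polynomials
the claim is algebra. -/
theorem cfc_unitaryDiag {U : Matrix ι ι ℂ} (hU : U ∈ Matrix.unitaryGroup ι ℂ) (s : ι → ℝ)
    (f : ℝ → ℝ) : cfc f (unitaryDiag U s) = unitaryDiag U fun i => f (s i) := by
  classical
  have hH : IsSelfAdjoint (unitaryDiag U s) := isHermitian_unitaryDiag U s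
  have hfin : (spectrum ℝ (unitaryDiag U s)).Finite := Set.toFinite _
  -- Adding the values of `s` as nodes avoids identifying them with the spectrum.
  set t : Finset ℝ := hfin.toFinset ∪ Finset.univ.image s
  set q : Polynomial ℝ := Lagrange.interpolate t id f
  have hq : ∀ x ∈ t, q.eval x = f x := fun x hx =>
    Lagrange.eval_interpolate_at_node f (Set.injOn_id _) hx
  rw [cfc_congr (g := fun x => q.eval x) fun x hx => (hq x (by simp [t, hx])).symm,
    cfc_polynomial q _ hH, aeval_unitaryDiag hU]
  congr 1
  ext i
  exact hq _ (by simp [t])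

/-! ### Kernels, ranges and the support condition -/

theorem unitaryDiag_mulVec_eq_zero_iff {U : Matrix ι ι ℂ} (hU : U ∈ Matrix.unitaryGroup ι ℂ)
    (s : ι → ℝ) (v : ι → ℂ) :
    unitaryDiag U s *ᵥ v = 0 ↔ ∀ i, s i = 0 ∨ (Uᴴ *ᵥ v) i = 0 := by
  have h := conjTranspose_mul_self_of_mem_unitaryGroup hU
  have h1 : unitaryDiag U s *ᵥ v = U *ᵥ (Matrix.diagonal (fun i => (s i : ℂ)) *ᵥ (Uᴴ *ᵥ v)) := by
    simp [unitaryDiag, Matrix.mulVec_mulVec, Matrix.mul_assoc]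
  have h2 : U *ᵥ (Matrix.diagonal (fun i => (s i : ℂ)) *ᵥ (Uᴴ *ᵥ v)) = 0 ↔
      Matrix.diagonal (fun i => (s i : ℂ)) *ᵥ (Uᴴ *ᵥ v) = 0 := by
    refine ⟨fun h0 => ?_, fun h0 => by rw [h0, Matrix.mulVec_zero]⟩
    have := congrArg (fun w => Uᴴ *ᵥ w) h0
    simpa only [Matrix.mulVec_mulVec, ← Matrix.mul_assoc, h, Matrix.one_mul,
      Matrix.mulVec_zero] using this
  rw [h1, h2, funext_iff]
  refine forall_congr' fun i => ?_
  rw [Matrix.mulVec_diagonal]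
  simp

/-- For Hermitian operators, inclusion of ranges is reversed inclusion of kernels. -/
theorem range_mulVecLin_le_iff {X Y : Matrix ι ι ℂ} (hX : X.IsHermitian) (hY : Y.IsHermitian) :
    LinearMap.range X.mulVecLin ≤ LinearMap.range Y.mulVecLin ↔
      ∀ v, Y *ᵥ v = 0 → X *ᵥ v = 0 := by
  constructor
  · intro h v hv
    have hXX : X *ᵥ (X *ᵥ v) ∈ LinearMap.range Y.mulVecLin := h ⟨X *ᵥ v, rfl⟩
    obtain ⟨w, hw⟩ := hXX
    rw [Matrix.mulVecLin_apply] at hw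
    -- ‖Xv‖² = ⟨v, XXv⟩ = ⟨v, Yw⟩ = ⟨Yv, w⟩ = 0.
    have : star (X *ᵥ v) ⬝ᵥ (X *ᵥ v) = 0 := by
      rw [Matrix.star_mulVec, ← Matrix.dotProduct_mulVec, hX.eq, ← hw, Matrix.dotProduct_mulVec,
        ← hY.eq, ← Matrix.star_mulVec, hv]
      simp
    exact dotProduct_star_self_eq_zero.1 this
  · intro h
    obtain ⟨U, hU, s, rfl⟩ := exists_eq_unitaryDiag hY
    have hU1 := conjTranspose_mul_self_of_mem_unitaryGroup hU
    have hU2 := mul_conjTranspose_self_of_mem_unitaryGroup hU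
    rintro _ ⟨v, rfl⟩
    -- The pseudo-inverse of Y applied to Xv. Where `s i = 0` the quotient is 0 by convention, which
    -- is harmless: the kernel hypothesis makes that coordinate of Xv vanish.
    refine ⟨U *ᵥ (fun i => (Uᴴ *ᵥ (X *ᵥ v)) i / s i), ?_⟩
    rw [Matrix.mulVecLin_apply, Matrix.mulVecLin_apply, Matrix.mulVec_mulVec]
    have e : unitaryDiag U s * U = U * Matrix.diagonal fun i => (s i : ℂ) := by
      rw [unitaryDiag, Matrix.mul_assoc, hU1, Matrix.mul_one]
    rw [e, ← Matrix.mulVec_mulVec]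
    have e2 : (Matrix.diagonal fun i => (s i : ℂ)) *ᵥ
        (fun i => (Uᴴ *ᵥ (X *ᵥ v)) i / (s i : ℂ)) = Uᴴ *ᵥ (X *ᵥ v) := by
      ext i
      rw [Matrix.mulVec_diagonal]
      by_cases hi : s i = 0
      · have hk : unitaryDiag U s *ᵥ (U *ᵥ Pi.single i 1) = 0 := by
          rw [unitaryDiag_mulVec_eq_zero_iff hU]
          intro j
          rw [Matrix.mulVec_mulVec, hU1, Matrix.one_mulVec]
          by_cases hj : j = i
          · left; rw [hj, hi]
          · right; simp [hj]
        have h0 := h _ hk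
        have : (Uᴴ *ᵥ (X *ᵥ v)) i = star (X *ᵥ (U *ᵥ Pi.single i 1)) ⬝ᵥ v := by
          rw [Matrix.star_mulVec, ← Matrix.dotProduct_mulVec, hX.eq, Matrix.star_mulVec,
            ← Matrix.dotProduct_mulVec]
          simp
        rw [this, h0]
        simp [hi]
      · field_simp
    rw [e2, Matrix.mulVec_mulVec, hU2, Matrix.one_mulVec]

/-- For positive semidefinite X, ⟨u, Xu⟩ = 0 forces Xu = 0, so diagonal entries detect the kernel.
The support condition thereby becomes absolute continuity of the diagonal of X with respect to `s`.
-/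
theorem range_mulVecLin_le_unitaryDiag_iff {X U : Matrix ι ι ℂ} (hX : X.PosSemidef)
    (hU : U ∈ Matrix.unitaryGroup ι ℂ) (s : ι → ℝ) :
    LinearMap.range X.mulVecLin ≤ LinearMap.range (unitaryDiag U s).mulVecLin ↔
      ∀ i, s i = 0 → diagIn U X i = 0 := by
  have hU1 := conjTranspose_mul_self_of_mem_unitaryGroup hU
  have hU2 := mul_conjTranspose_self_of_mem_unitaryGroup hU
  have key : ∀ i, diagIn U X i = 0 ↔ X *ᵥ (U *ᵥ Pi.single i 1) = 0 := by
    intro i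
    rw [← hX.dotProduct_mulVec_zero_iff, Matrix.star_mulVec]
    have e : star (Pi.single i (1 : ℂ)) ᵥ* Uᴴ ⬝ᵥ X *ᵥ U *ᵥ Pi.single i 1 =
        (Uᴴ * X * U) i i := by
      rw [← Matrix.dotProduct_mulVec, Matrix.mulVec_mulVec, Matrix.mulVec_mulVec]
      simp [Matrix.mul_assoc]
    rw [e, diagIn]
    have h0 : 0 ≤ (Uᴴ * X * U) i i := (hX.conjTranspose_mul_mul_same U).diag_nonneg
    refine ⟨fun h => Complex.ext h (Complex.le_def.1 h0).2.symm, fun h => by rw [h]; rfl⟩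
  rw [range_mulVecLin_le_iff hX.1 (isHermitian_unitaryDiag U s)]
  constructor
  · intro h i hi
    refine (key i).2 (h _ ?_)
    rw [unitaryDiag_mulVec_eq_zero_iff hU]
    intro j
    rw [Matrix.mulVec_mulVec, hU1, Matrix.one_mulVec]
    by_cases hj : j = i
    · left; rw [hj, hi]
    · right; simp [hj]
  · intro h v hv
    rw [unitaryDiag_mulVec_eq_zero_iff hU] at hv
    have hv' : v = U *ᵥ ∑ i, Pi.single i ((Uᴴ *ᵥ v) i) := by
      rw [Finset.univ_sum_single, Matrix.mulVec_mulVec, hU2, Matrix.one_mulVec]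
    rw [hv', Matrix.mulVec_sum, Matrix.mulVec_sum]
    refine Finset.sum_eq_zero fun i _ => ?_
    rcases hv i with hi | hi
    · have e : (Pi.single i ((Uᴴ *ᵥ v) i) : ι → ℂ) = (Uᴴ *ᵥ v) i • Pi.single i (1 : ℂ) := by
        rw [← Pi.single_smul]; simp
      rw [e, Matrix.mulVec_smul, Matrix.mulVec_smul, (key i).1 (h i hi), smul_zero]
    · rw [hi, Pi.single_zero, Matrix.mulVec_zero, Matrix.mulVec_zero]

/-- The Shannon entropy in nats. -/
noncomputable def shannon (r : ι → ℝ) : ℝ := ∑ i, Real.negMulLog (r i)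

/-! ### Entropic quantities of diagonalized operators -/

theorem trace_mul_opLog {U : Matrix ι ι ℂ} (hU : U ∈ Matrix.unitaryGroup ι ℂ) (s : ι → ℝ)
    (X : Matrix ι ι ℂ) :
    (X * opLog (unitaryDiag U s)).trace.re = (∑ i, diagIn U X i * Real.log (s i)) / Real.log 2 := by
  rw [opLog, cfc_unitaryDiag hU, trace_mul_unitaryDiag, Finset.sum_div]
  simp only [Real.logb, mul_div_assoc]

theorem trace_mul_opLog_self {U : Matrix ι ι ℂ} (hU : U ∈ Matrix.unitaryGroup ι ℂ) (s : ι → ℝ) :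
    (unitaryDiag U s * opLog (unitaryDiag U s)).trace.re = -shannon s / Real.log 2 := by
  rw [trace_mul_opLog hU, diagIn_unitaryDiag_self hU, shannon, ← Finset.sum_neg_distrib]
  simp [Real.negMulLog]

/-- Only the diagonal of φ in the eigenbasis of σ meets log σ, so the second term is a classical
cross entropy. -/
theorem relEntropy_unitaryDiag {U V : Matrix ι ι ℂ} {s t : ι → ℝ}
    (hV : V ∈ Matrix.unitaryGroup ι ℂ) (hU : U ∈ Matrix.unitaryGroup ι ℂ) (ht : ∀ i, 0 ≤ t i)
    (h : ∀ i, s i = 0 → diagIn U (unitaryDiag V t) i = 0) :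
    relEntropy (unitaryDiag V t) (unitaryDiag U s) =
      (((-shannon t - ∑ i, diagIn U (unitaryDiag V t) i * Real.log (s i)) / Real.log 2 : ℝ) :
        EReal) := by
  rw [relEntropy, if_pos ((range_mulVecLin_le_unitaryDiag_iff (posSemidef_unitaryDiag V ht) hU s).2
    h), trace_mul_opLog hU, trace_mul_opLog_self hV, sub_div]

theorem relEntropy_unitaryDiag_of_not {U V : Matrix ι ι ℂ} {s t : ι → ℝ}
    (hU : U ∈ Matrix.unitaryGroup ι ℂ) (ht : ∀ i, 0 ≤ t i)
    (h : ¬ ∀ i, s i = 0 → diagIn U (unitaryDiag V t) i = 0) :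
    relEntropy (unitaryDiag V t) (unitaryDiag U s) = ⊤ := by
  rw [relEntropy, if_neg fun h' =>
    h ((range_mulVecLin_le_unitaryDiag_iff (posSemidef_unitaryDiag V ht) hU s).1 h')]

theorem IsState.exists_eq_unitaryDiag {φ : Matrix ι ι ℂ} (hφ : IsState φ) :
    ∃ V ∈ Matrix.unitaryGroup ι ℂ, ∃ t : ι → ℝ, (∀ i, 0 ≤ t i) ∧ ∑ i, t i = 1 ∧
      φ = unitaryDiag V t := by
  obtain ⟨V, hV, t, rfl⟩ := _root_.exists_eq_unitaryDiag hφ.1.1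
  refine ⟨V, hV, t, fun i => ?_, ?_, rfl⟩
  · rw [← congrFun (diagIn_unitaryDiag_self hV t) i]
    exact diagIn_nonneg hφ.1 V i
  · have := hφ.2
    rw [trace_unitaryDiag hV] at this
    exact_mod_cast this

theorem isState_unitaryDiag {U : Matrix ι ι ℂ} (hU : U ∈ Matrix.unitaryGroup ι ℂ) {s : ι → ℝ}
    (hs : ∀ i, 0 ≤ s i) (hs1 : ∑ i, s i = 1) : IsState (unitaryDiag U s) :=
  ⟨posSemidef_unitaryDiag U hs, by rw [trace_unitaryDiag hU, hs1, Complex.ofReal_one]⟩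

theorem IsState.sum_diagIn {φ U : Matrix ι ι ℂ} (hφ : IsState φ)
    (hU : U ∈ Matrix.unitaryGroup ι ℂ) : ∑ i, diagIn U φ i = 1 := by
  rw [_root_.sum_diagIn hU, hφ.2, Complex.one_re]

end Diagonalization

/-! ### Shannon entropy -/

section Shannon

theorem negMulLog_add_mul_log_le {r s : ℝ} (hr : 0 ≤ r) (hs : 0 < s) :
    Real.negMulLog r + r * Real.log s ≤ s - r := by
  rcases hr.eq_or_lt with rfl | hr
  · simpa using hs.le
  · have h := Real.log_le_sub_one_of_pos (div_pos hs hr)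
    rw [Real.log_div hs.ne' hr.ne'] at h
    have h2 := mul_le_mul_of_nonneg_left h hr.le
    rw [mul_sub, mul_sub, mul_div_cancel₀ _ hr.ne'] at h2
    rw [Real.negMulLog]
    linarith

theorem negMulLog_add_le {a b : ℝ} (ha : 0 ≤ a) (hb : 0 ≤ b) :
    Real.negMulLog (a + b) ≤ Real.negMulLog a + Real.negMulLog b := by
  rcases ha.eq_or_lt with rfl | ha
  · simp
  rcases hb.eq_or_lt with rfl | hb
  · simp
  have h1 : Real.log a ≤ Real.log (a + b) := Real.log_le_log ha (by linarith)
  have h2 : Real.log b ≤ Real.log (a + b) := Real.log_le_log hb (by linarith)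
  have h3 := mul_le_mul_of_nonneg_left h1 ha.le
  have h4 := mul_le_mul_of_nonneg_left h2 hb.le
  simp only [Real.negMulLog]
  linarith

variable {ι κ : Type} [Fintype ι] [Fintype κ]

/-- Gibbs' inequality, from log x ≤ x - 1 applied termwise; the linear bounds cancel because the
total masses agree. -/
theorem shannon_le_neg_sum_mul_log {r s : ι → ℝ} (hr : ∀ i, 0 ≤ r i) (hs : ∀ i, 0 ≤ s i)
    (h : ∑ i, s i = ∑ i, r i) (h0 : ∀ i, s i = 0 → r i = 0) :
    shannon r ≤ -∑ i, r i * Real.log (s i) := by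
  have key : ∑ i, (Real.negMulLog (r i) + r i * Real.log (s i)) ≤ ∑ i, (s i - r i) := by
    refine Finset.sum_le_sum fun i _ => ?_
    rcases (hs i).eq_or_lt with hi | hi
    · simp [h0 i hi.symm, ← hi]
    · exact negMulLog_add_mul_log_le (hr i) hi
  rw [Finset.sum_add_distrib, Finset.sum_sub_distrib, h] at key
  unfold shannon
  linarith

/-- Gibbs' inequality against the uniform distribution of the same mass. Arbitrary mass is allowed
because it is applied to the excess part of a distribution. -/
theorem shannon_le {u : ι → ℝ} (hu : ∀ i, 0 ≤ u i) :
    shannon u ≤ (∑ i, u i) * Real.log (Fintype.card ι) + Real.negMulLog (∑ i, u i) := by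
  set ε := ∑ i, u i with hε
  rcases (Finset.sum_nonneg fun i _ => hu i : 0 ≤ ∑ i, u i).eq_or_lt with h0 | hpos
  · have h : ∀ i, u i = 0 := fun i =>
      (Finset.sum_eq_zero_iff_of_nonneg fun i _ => hu i).1 h0.symm i (Finset.mem_univ i)
    simp [shannon, hε, h]
  · have hne : Nonempty ι := by
      by_contra hne
      rw [not_nonempty_iff] at hne
      simp at hpos
    have hd : (0 : ℝ) < Fintype.card ι := by exact_mod_cast Fintype.card_pos
    have key := shannon_le_neg_sum_mul_log (s := fun _ => ε / Fintype.card ι) hu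
      (fun _ => (div_pos hpos hd).le) (by simp; field_simp; exact hε)
      (fun i hi => absurd hi (div_pos hpos hd).ne')
    rw [← Finset.sum_mul, ← hε, Real.log_div hpos.ne' hd.ne'] at key
    rw [Real.negMulLog]
    linarith

theorem shannon_nonneg {r : ι → ℝ} (hr : ∀ i, 0 ≤ r i) (h : ∑ i, r i = 1) : 0 ≤ shannon r :=
  Finset.sum_nonneg fun i _ => Real.negMulLog_nonneg (hr i)
    (h ▸ Finset.single_le_sum (fun j _ => hr j) (Finset.mem_univ i))

theorem continuous_shannon : Continuous (shannon : (ι → ℝ) → ℝ) := by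
  unfold shannon
  fun_prop

/-- Entropy does not decrease under doubly stochastic maps. -/
theorem shannon_le_of_doublyStochastic {W : ι → κ → ℝ} {s : κ → ℝ} (hW : ∀ i j, 0 ≤ W i j)
    (hrow : ∀ i, ∑ j, W i j = 1) (hcol : ∀ j, ∑ i, W i j = 1) (hs : ∀ j, 0 ≤ s j) :
    shannon s ≤ shannon fun i => ∑ j, W i j * s j := by
  have h : ∀ i, ∑ j, W i j * Real.negMulLog (s j) ≤ Real.negMulLog (∑ j, W i j * s j) := fun i =>
    Real.concaveOn_negMulLog.le_map_sum (fun j _ => hW i j) (hrow i) fun j _ => hs j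
  calc shannon s = ∑ j, ∑ i, W i j * Real.negMulLog (s j) := by
        simp_rw [← Finset.sum_mul, hcol, one_mul]; rfl
    _ = ∑ i, ∑ j, W i j * Real.negMulLog (s j) := Finset.sum_comm
    _ ≤ _ := Finset.sum_le_sum fun i _ => h i

/-- The Fannes–Audenaert bound for probability distributions. -/
theorem shannon_sub_le {r s : ι → ℝ} {ε : ℝ} (hr : ∀ i, 0 ≤ r i) (hs : ∀ i, 0 ≤ s i)
    (hr1 : ∑ i, r i = 1) (hs1 : ∑ i, s i = 1) (h : ∑ i, |r i - s i| ≤ 2 * ε) (hε : ε ≤ 1) :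
    shannon r - shannon s ≤ ε * Real.log (Fintype.card ι) + Real.binEntropy ε := by
  have hε0 : 0 ≤ ε := by
    have : 0 ≤ ∑ i, |r i - s i| := Finset.sum_nonneg fun i _ => abs_nonneg _
    linarith
  -- The case ε = 1 is separate because the main argument divides by 1 - ε and by the mass of the
  -- overlap.
  rcases hε.eq_or_lt with rfl | hε
  · have h1 := shannon_le hr
    have h2 := shannon_nonneg hs hs1
    rw [hr1] at h1
    simp at h1 ⊢
    linarith
  set μ : ι → ℝ := fun i => min (r i) (s i)
  set M := ∑ i, μ i with hM
  have hμ0 : ∀ i, 0 ≤ μ i := fun i => le_min (hr i) (hs i)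
  have hM1 : 1 - ε ≤ M := by
    have e : ∀ i, μ i = (r i + s i - |r i - s i|) / 2 := by
      intro i
      rcases le_total (r i) (s i) with h | h
      · simp only [μ, min_eq_left h, abs_of_nonpos (sub_nonpos.2 h)]
        ring
      · simp only [μ, min_eq_right h, abs_of_nonneg (sub_nonneg.2 h)]
        ring
    rw [hM, Finset.sum_congr rfl fun i _ => e i, ← Finset.sum_div, Finset.sum_sub_distrib,
      Finset.sum_add_distrib, hr1, hs1]
    linarith
  have hMpos : 0 < M := by linarith
  -- The overlap min(r, s) has mass at least 1 - ε; rescaling by `c` gives a common part `m` of mass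
  -- exactly 1 - ε, leaving excesses of mass ε in both distributions.
  set c := (1 - ε) / M
  have hc0 : 0 < c := div_pos (by linarith) hMpos
  have hc1 : c ≤ 1 := (div_le_one hMpos).2 hM1
  set m : ι → ℝ := fun i => c * μ i with hm
  have hm0 : ∀ i, 0 ≤ m i := fun i => mul_nonneg hc0.le (hμ0 i)
  have hmμ : ∀ i, m i ≤ μ i := fun i => mul_le_of_le_one_left (hμ0 i) hc1
  have hmsum : ∑ i, m i = 1 - ε := by
    rw [hm, ← Finset.mul_sum, ← hM]
    exact div_mul_cancel₀ _ hMpos.ne'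
  have hu0 : ∀ i, 0 ≤ r i - m i := fun i => sub_nonneg.2 ((hmμ i).trans (min_le_left _ _))
  have hv0 : ∀ i, 0 ≤ s i - m i := fun i => sub_nonneg.2 ((hmμ i).trans (min_le_right _ _))
  have hu1 : ∑ i, (r i - m i) = ε := by rw [Finset.sum_sub_distrib, hr1, hmsum]; ring
  have hv1 : ∑ i, (s i - m i) = ε := by rw [Finset.sum_sub_distrib, hs1, hmsum]; ring
  have upper : shannon r ≤ shannon m + (ε * Real.log (Fintype.card ι) + Real.negMulLog ε) := by
    have h1 : shannon r ≤ shannon m + shannon fun i => r i - m i := by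
      unfold shannon
      rw [← Finset.sum_add_distrib]
      refine Finset.sum_le_sum fun i _ => ?_
      simpa using negMulLog_add_le (hm0 i) (hu0 i)
    have h2 := shannon_le hu0
    rw [hu1] at h2
    linarith
  have lower : shannon m - Real.negMulLog (1 - ε) ≤ shannon s := by
    have h1ε : 0 < 1 - ε := by linarith
    -- Concavity along s = (1 - ε) · m/(1 - ε) + ε · (s - m)/ε, dropping the nonnegative entropy of
    -- the second part. For ε = 0 the second quotient is meaningless, but then s = m.
    have hterm : ∀ i, Real.negMulLog (m i) + m i * Real.log (1 - ε) ≤ Real.negMulLog (s i) := by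
      intro i
      rcases (hm0 i).eq_or_lt with h0 | h0
      · rw [← h0]
        simpa using Real.negMulLog_nonneg (hs i)
          (hs1 ▸ Finset.single_le_sum (fun j _ => hs j) (Finset.mem_univ i))
      · have hms : m i ≤ s i := sub_nonneg.1 (hv0 i)
        have hle : Real.negMulLog (m i) + m i * Real.log (1 - ε) =
            (1 - ε) * Real.negMulLog (m i / (1 - ε)) := by
          rw [Real.negMulLog, Real.negMulLog, Real.log_div h0.ne' h1ε.ne']
          field_simp
          ring
        rw [hle]
        rcases hε0.eq_or_lt with he | he
        · subst he
          have hvi : s i - m i = 0 :=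
            (Finset.sum_eq_zero_iff_of_nonneg fun i _ => hv0 i).1 hv1 i (Finset.mem_univ i)
          have : s i = m i := by linarith
          simp [this]
        · have hb0 : 0 ≤ (s i - m i) / ε := div_nonneg (hv0 i) he.le
          have hb1 : (s i - m i) / ε ≤ 1 := by
            rw [div_le_one he, ← hv1]
            exact Finset.single_le_sum (f := fun i => s i - m i) (fun j _ => hv0 j)
              (Finset.mem_univ i)
          have hconc := Real.concaveOn_negMulLog.2 (div_nonneg h0.le h1ε.le : 0 ≤ m i / (1 - ε))
            (hb0 : (s i - m i) / ε ∈ Set.Ici 0) h1ε.le he.le (by ring)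
          have hsi : (1 - ε) • (m i / (1 - ε)) + ε • ((s i - m i) / ε) = s i := by
            simp only [smul_eq_mul]
            field_simp
            ring
          rw [hsi] at hconc
          have hn := mul_nonneg he.le (Real.negMulLog_nonneg hb0 hb1)
          simp only [smul_eq_mul] at hconc
          linarith
    have hsum := Finset.sum_le_sum fun i (_ : i ∈ Finset.univ) => hterm i
    rw [Finset.sum_add_distrib, ← Finset.sum_mul, hmsum] at hsum
    unfold shannon
    rw [Real.negMulLog]
    linarith
  rw [Real.binEntropy_eq_negMulLog_add_negMulLog_one_sub]
  linarith

theorem shannon_comp_equiv (e : κ ≃ ι) (r : ι → ℝ) : shannon (r ∘ e) = shannon r :=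
  Equiv.sum_comp e fun i => Real.negMulLog (r i)

theorem shannon_mul {r : ι → ℝ} {s : κ → ℝ} (hr : ∑ i, r i = 1) (hs : ∑ i, s i = 1) :
    (shannon fun x : ι × κ => r x.1 * s x.2) = shannon r + shannon s := by
  simp only [shannon, Fintype.sum_prod_type, Real.negMulLog_mul, Finset.sum_add_distrib,
    ← Finset.sum_mul, ← Finset.mul_sum, hr, hs, one_mul]

end Shannon

theorem h₂_eq (x : ℝ) : h₂ x = Real.binEntropy x / Real.log 2 := by
  rw [Real.binEntropy_eq_negMulLog_add_negMulLog_one_sub, h₂, Real.negMulLog, Real.negMulLog]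
  simp only [Real.logb]
  ring

/-- Dephasing acts on the spectrum by the doubly stochastic overlap matrix. -/
theorem shannon_le_shannon_diagIn {ι : Type} [Fintype ι] [DecidableEq ι] {U V : Matrix ι ι ℂ}
    (hU : U ∈ Matrix.unitaryGroup ι ℂ) (hV : V ∈ Matrix.unitaryGroup ι ℂ) {t : ι → ℝ}
    (ht : ∀ i, 0 ≤ t i) : shannon t ≤ shannon (diagIn U (unitaryDiag V t)) := by
  have hW := conjTranspose_mul_mem_unitaryGroup hU hV
  have := shannon_le_of_doublyStochastic (W := fun i j => Complex.normSq ((Uᴴ * V) i j))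
    (fun _ _ => Complex.normSq_nonneg _) (sum_normSq_row hW) (sum_normSq_col hW) ht
  rwa [← funext fun i => diagIn_unitaryDiag U V t i] at this

/-! ### The data-processing inequality for the relative entropy -/

section Channels

variable {ι κ μ : Type} [Fintype ι] [Fintype κ] [Fintype μ]

/-- Two-positivity, applied to the positive block operator `(Cₐ† C_b)`. -/
theorem IsChannel.posSemidef_block {N : Matrix ι ι ℂ →ₗ[ℂ] Matrix κ κ ℂ} (hN : IsChannel N)
    (C : Fin 2 → Matrix μ ι ℂ) :
    (Matrix.of fun x y : κ × Fin 2 => N ((C x.2)ᴴ * C y.2) x.1 y.1).PosSemidef := by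
  have h : (Matrix.of fun x y : ι × Fin 2 => ((C x.2)ᴴ * C y.2) x.1 y.1).PosSemidef := by
    have e : (Matrix.of fun x y : ι × Fin 2 => ((C x.2)ᴴ * C y.2) x.1 y.1) =
        (Matrix.of fun (k : μ) (y : ι × Fin 2) => C y.2 k y.1)ᴴ *
          Matrix.of fun (k : μ) (y : ι × Fin 2) => C y.2 k y.1 := by
      ext x y
      simp [Matrix.mul_apply]
    rw [e]
    exact Matrix.posSemidef_conjTranspose_mul_self _
  exact hN.completely_positive 2 _ h

theorem IsChannel.map_posSemidef {N : Matrix ι ι ℂ →ₗ[ℂ] Matrix κ κ ℂ} (hN : IsChannel N)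
    {X : Matrix ι ι ℂ} (hX : X.PosSemidef) : (N X).PosSemidef :=
  (hN.completely_positive 1 (X.submatrix Prod.fst Prod.fst) (hX.submatrix _)).submatrix
    fun i => (i, (0 : Fin 1))

theorem IsChannel.map_isState {N : Matrix ι ι ℂ →ₗ[ℂ] Matrix κ κ ℂ} (hN : IsChannel N)
    {φ : Matrix ι ι ℂ} (hφ : IsState φ) : IsState (N φ) :=
  ⟨hN.map_posSemidef hφ.1, by rw [hN.trace_preserving, hφ.2]⟩

/-- The block operator built from (1, X) has N(X) and N(X†) as its off-diagonal blocks, and it is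
Hermitian. -/
theorem IsChannel.map_conjTranspose [DecidableEq ι] {N : Matrix ι ι ℂ →ₗ[ℂ] Matrix κ κ ℂ}
    (hN : IsChannel N) (X : Matrix ι ι ℂ) : N Xᴴ = (N X)ᴴ := by
  ext i j
  have h := (hN.posSemidef_block ![1, X]).1.apply (i, 1) (j, 0)
  simpa using h.symm

/-- The Kadison–Schwarz inequality for the adjoint of a channel, tested on a positive operator. -/
theorem IsChannel.schwarz [DecidableEq ι] [DecidableEq κ]
    {N : Matrix ι ι ℂ →ₗ[ℂ] Matrix κ κ ℂ} (hN : IsChannel N)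
    {σ : Matrix ι ι ℂ} (hσ : σ.PosSemidef) {Y : Matrix κ κ ℂ} {Z : Matrix ι ι ℂ}
    (hZ : ∀ X, (X * Z).trace = (N X * Y).trace) :
    (σ * Z * Zᴴ).trace.re ≤ (N σ * Y * Yᴴ).trace.re := by
  obtain ⟨R, rfl⟩ : ∃ R : Matrix ι ι ℂ, σ = Rᴴ * R := by
    open scoped MatrixOrder in
    exact CStarAlgebra.nonneg_iff_eq_star_mul_self.1 (Matrix.nonneg_iff_posSemidef.2 hσ)
  set σ := Rᴴ * R with hσ'
  -- With σ = R†R, compressing this block operator by the column (Y, 1) gives Y†N(σ)Y - Y†N(σZ) -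
  -- N(Z†σ)Y + N(Z†σZ) ≥ 0. By duality each cross term has real trace tr(Z†σZ), so taking traces
  -- yields the claim.
  have hP := hN.posSemidef_block ![R, -(R * Z)]
  have hK := hP.conjTranspose_mul_mul_same
    (Matrix.of fun (x : κ × Fin 2) (j : κ) => (![Y, 1] : Fin 2 → Matrix κ κ ℂ) x.2 x.1 j)
  have e1 : Rᴴ * (R * Z) = σ * Z := by rw [← Matrix.mul_assoc]
  have e2 : Zᴴ * Rᴴ * R = Zᴴ * σ := by rw [Matrix.mul_assoc]
  have e3 : Zᴴ * Rᴴ * (R * Z) = Zᴴ * σ * Z := by simp only [hσ', Matrix.mul_assoc]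
  have e : (Matrix.of fun (x : κ × Fin 2) (j : κ) =>
      (![Y, 1] : Fin 2 → Matrix κ κ ℂ) x.2 x.1 j)ᴴ *
      (Matrix.of fun x y : κ × Fin 2 => N ((![R, -(R * Z)] x.2)ᴴ * ![R, -(R * Z)] y.2) x.1 y.1) *
      (Matrix.of fun (x : κ × Fin 2) (j : κ) => (![Y, 1] : Fin 2 → Matrix κ κ ℂ) x.2 x.1 j) =
      Yᴴ * N σ * Y - Yᴴ * N (σ * Z) - N (Zᴴ * σ) * Y + N (Zᴴ * σ * Z) := by
    ext i j
    rw [Matrix.mul_apply]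
    simp only [Matrix.mul_apply (M := Matrix.conjTranspose _), Fintype.sum_prod_type,
      Fin.sum_univ_two, Matrix.of_apply, Matrix.conjTranspose_apply]
    simp [e1, e2, e3, Matrix.mul_apply, Matrix.one_apply, Finset.sum_add_distrib, add_mul,
      Finset.sum_neg_distrib]
    ring
  rw [e] at hK
  have h0 := (Complex.le_def.1 hK.trace_nonneg).1
  rw [Matrix.trace_add, Matrix.trace_sub, Matrix.trace_sub, ← hZ, hN.trace_preserving] at h0
  have h1 : (Yᴴ * N (σ * Z)).trace = star (N (Zᴴ * σ) * Y).trace := by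
    rw [← Matrix.trace_conjTranspose, Matrix.conjTranspose_mul, ← hN.map_conjTranspose,
      Matrix.conjTranspose_mul, Matrix.conjTranspose_conjTranspose, hσ.1.eq]
  rw [h1, ← hZ] at h0
  have h2 : (Yᴴ * N σ * Y).trace = (N σ * Y * Yᴴ).trace := by
    rw [Matrix.mul_assoc, Matrix.trace_mul_comm]
  have h3 : (Zᴴ * σ * Z).trace = (σ * Z * Zᴴ).trace := by
    rw [Matrix.mul_assoc, Matrix.trace_mul_comm]
  rw [h2, h3] at h0
  simp at h0
  linarith

/-- The adjoint of N for the bilinear trace pairing, read off on matrix units. -/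
theorem exists_trace_dual [DecidableEq ι] (N : Matrix ι ι ℂ →ₗ[ℂ] Matrix κ κ ℂ)
    (Y : Matrix κ κ ℂ) :
    ∃ Z : Matrix ι ι ℂ, ∀ X, (X * Z).trace = (N X * Y).trace := by
  refine ⟨Matrix.of fun i j => (N (Matrix.single j i 1) * Y).trace, fun X => ?_⟩
  conv_rhs => rw [Matrix.matrix_eq_sum_single X]
  simp only [map_sum, Matrix.sum_mul, Matrix.trace_sum]
  simp only [Matrix.trace, Matrix.diag_apply, Matrix.mul_apply, Matrix.of_apply]
  refine Finset.sum_congr rfl fun i _ => Finset.sum_congr rfl fun j _ => ?_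
  have h : Matrix.single i j (X i j) = X i j • Matrix.single i j (1 : ℂ) := by
    rw [Matrix.smul_single, smul_eq_mul, mul_one]
  rw [h, map_smul]
  simp only [Matrix.smul_apply, smul_eq_mul, Finset.mul_sum, mul_assoc]

end Channels

/-! ### The resolvent form and its integral -/

section DataProcessing

variable {ι κ : Type} [Fintype ι] [DecidableEq ι] [Fintype κ] [DecidableEq κ]

/-- The variational functional whose supremum over `Y` is the resolvent form
`⟨φ^{1/2}, (Δ_{σ,φ} + T)⁻¹ φ^{1/2}⟩`. -/
noncomputable def resolventFunctional (φ σ : Matrix ι ι ℂ) (T : ℝ) (Y : Matrix ι ι ℂ) : ℝ :=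
  2 * (φ * Y).trace.re - (σ * Y * Yᴴ).trace.re - T * (φ * Yᴴ * Y).trace.re

/-- The resolvent form of two diagonalized operators with overlaps `w`. -/
noncomputable def resolventForm (w : ι → ι → ℝ) (s t : ι → ℝ) (T : ℝ) : ℝ :=
  ∑ j, ∑ i, w j i * (t i * t i / (s j + T * t i))

/-- In the coordinates y = U†YV, left multiplication by σ and right multiplication by φ are both
diagonal, so the functional splits into independent quadratics in the entries of y. -/
theorem resolventFunctional_eq {U V : Matrix ι ι ℂ} (hU : U ∈ Matrix.unitaryGroup ι ℂ)
    (hV : V ∈ Matrix.unitaryGroup ι ℂ) (s t : ι → ℝ) (T : ℝ) (y : Matrix ι ι ℂ) :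
    resolventFunctional (unitaryDiag V t) (unitaryDiag U s) T (U * y * Vᴴ) =
      ∑ j, ∑ i, (2 * t i * (star ((Uᴴ * V) j i) * y j i).re -
        (s j + T * t i) * Complex.normSq (y j i)) := by
  have hU1 := conjTranspose_mul_self_of_mem_unitaryGroup hU
  have hV1 := conjTranspose_mul_self_of_mem_unitaryGroup hV
  have h1 : (unitaryDiag V t * (U * y * Vᴴ)).trace.re =
      ∑ j, ∑ i, t i * (star ((Uᴴ * V) j i) * y j i).re := by
    rw [Matrix.trace_mul_comm, trace_mul_unitaryDiag, Finset.sum_comm]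
    refine Finset.sum_congr rfl fun i _ => ?_
    have e : Vᴴ * (U * y * Vᴴ) * V = (Uᴴ * V)ᴴ * y := by
      simp only [Matrix.conjTranspose_mul, Matrix.conjTranspose_conjTranspose, Matrix.mul_assoc,
        hV1, Matrix.mul_one]
    rw [diagIn, e, Matrix.mul_apply, Complex.re_sum, Finset.sum_mul]
    refine Finset.sum_congr rfl fun j _ => ?_
    rw [Matrix.conjTranspose_apply, mul_comm]
  have h2 : (unitaryDiag U s * (U * y * Vᴴ) * (U * y * Vᴴ)ᴴ).trace.re =
      ∑ j, ∑ i, s j * Complex.normSq (y j i) := by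
    rw [Matrix.mul_assoc, Matrix.trace_mul_comm, trace_mul_unitaryDiag]
    refine Finset.sum_congr rfl fun j _ => ?_
    have e : Uᴴ * (U * y * Vᴴ * (U * y * Vᴴ)ᴴ) * U = (Uᴴ * U) * (y * (Vᴴ * V) * yᴴ) * (Uᴴ * U) := by
      simp only [Matrix.conjTranspose_mul, Matrix.conjTranspose_conjTranspose, Matrix.mul_assoc]
    rw [diagIn, e, hU1, hV1, Matrix.one_mul, Matrix.mul_one, Matrix.mul_one, Matrix.mul_apply,
      Complex.re_sum, Finset.sum_mul]
    refine Finset.sum_congr rfl fun i _ => ?_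
    rw [Matrix.conjTranspose_apply, Complex.star_def, Complex.mul_conj, Complex.ofReal_re, mul_comm]
  have h3 : (unitaryDiag V t * (U * y * Vᴴ)ᴴ * (U * y * Vᴴ)).trace.re =
      ∑ j, ∑ i, t i * Complex.normSq (y j i) := by
    rw [Matrix.mul_assoc, Matrix.trace_mul_comm, trace_mul_unitaryDiag, Finset.sum_comm]
    refine Finset.sum_congr rfl fun i _ => ?_
    have e : Vᴴ * ((U * y * Vᴴ)ᴴ * (U * y * Vᴴ)) * V = (Vᴴ * V) * (yᴴ * (Uᴴ * U) * y) * (Vᴴ * V) := by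
      simp only [Matrix.conjTranspose_mul, Matrix.conjTranspose_conjTranspose, Matrix.mul_assoc]
    rw [diagIn, e, hU1, hV1, Matrix.one_mul, Matrix.mul_one, Matrix.mul_one, Matrix.mul_apply,
      Complex.re_sum, Finset.sum_mul]
    refine Finset.sum_congr rfl fun j _ => ?_
    rw [Matrix.conjTranspose_apply, mul_comm, Complex.star_def, mul_comm (starRingEnd ℂ _),
      Complex.mul_conj, Complex.ofReal_re]
  rw [resolventFunctional, h1, h2, h3]
  simp only [Finset.mul_sum, ← Finset.sum_sub_distrib]
  refine Finset.sum_congr rfl fun j _ => Finset.sum_congr rfl fun i _ => ?_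
  ring

theorem resolventFunctional_le {U V : Matrix ι ι ℂ} (hU : U ∈ Matrix.unitaryGroup ι ℂ)
    (hV : V ∈ Matrix.unitaryGroup ι ℂ) {s t : ι → ℝ} (hs : ∀ i, 0 ≤ s i) (ht : ∀ i, 0 ≤ t i)
    {T : ℝ} (hT : 0 < T) (Y : Matrix ι ι ℂ) :
    resolventFunctional (unitaryDiag V t) (unitaryDiag U s) T Y ≤
      resolventForm (fun j i => Complex.normSq ((Uᴴ * V) j i)) s t T := by
  have hY : Y = U * (Uᴴ * Y * V) * Vᴴ := by
    calc Y = (U * Uᴴ) * Y * (V * Vᴴ) := by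
          rw [mul_conjTranspose_self_of_mem_unitaryGroup hU,
            mul_conjTranspose_self_of_mem_unitaryGroup hV, Matrix.one_mul, Matrix.mul_one]
      _ = _ := by simp only [Matrix.mul_assoc]
  rw [hY, resolventFunctional_eq hU hV]
  refine Finset.sum_le_sum fun j _ => Finset.sum_le_sum fun i _ => ?_
  beta_reduce
  generalize (Uᴴ * Y * V) j i = y
  generalize (Uᴴ * V) j i = w
  rcases (add_nonneg (hs j) (mul_nonneg hT.le (ht i))).eq_or_lt with h | h
  -- A vanishing denominator forces s_j = t_i = 0, and then both sides are 0; otherwise one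
  -- completes the square.
  · have h0 := (add_eq_zero_iff_of_nonneg (hs j) (mul_nonneg hT.le (ht i))).1 h.symm
    simp [h0.1, (mul_eq_zero.1 h0.2).resolve_left hT.ne']
  · rw [← mul_div_assoc, le_div_iff₀ h]
    simp only [Complex.normSq_apply, Complex.star_def, Complex.mul_re, Complex.conj_re,
      Complex.conj_im]
    nlinarith [sq_nonneg (t i * w.re - (s j + T * t i) * y.re),
      sq_nonneg (t i * w.im - (s j + T * t i) * y.im)]

theorem exists_resolventFunctional_eq {U V : Matrix ι ι ℂ} (hU : U ∈ Matrix.unitaryGroup ι ℂ)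
    (hV : V ∈ Matrix.unitaryGroup ι ℂ) (s t : ι → ℝ) (T : ℝ) :
    ∃ Y, resolventFunctional (unitaryDiag V t) (unitaryDiag U s) T Y =
      resolventForm (fun j i => Complex.normSq ((Uᴴ * V) j i)) s t T := by
  -- The critical point of each entrywise quadratic; a zero denominator gives 0 on both sides.
  refine ⟨U * (Matrix.of fun j i => ((t i / (s j + T * t i) : ℝ) : ℂ) * (Uᴴ * V) j i) * Vᴴ, ?_⟩
  rw [resolventFunctional_eq hU hV]
  refine Finset.sum_congr rfl fun j _ => Finset.sum_congr rfl fun i _ => ?_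
  rw [Matrix.of_apply]
  beta_reduce
  generalize (Uᴴ * V) j i = w
  simp only [Complex.normSq_apply, Complex.star_def, Complex.mul_re, Complex.conj_re,
    Complex.conj_im, Complex.mul_im, Complex.ofReal_re, Complex.ofReal_im]
  generalize s j + T * t i = d
  rcases eq_or_ne d 0 with h | h
  · simp [h]
  · field_simp
    ring

/-- The maximizer Y for the output pair is pulled back to a trial operator Z for the input pair. The
linear term is unchanged, and Schwarz, for σ with Z and for φ with Z†, controls the quadratic ones.
-/
theorem resolventForm_le_of_isChannel {N : Matrix ι ι ℂ →ₗ[ℂ] Matrix κ κ ℂ} (hN : IsChannel N)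
    {U V : Matrix ι ι ℂ} {U' V' : Matrix κ κ ℂ} (hU : U ∈ Matrix.unitaryGroup ι ℂ)
    (hV : V ∈ Matrix.unitaryGroup ι ℂ) (hU' : U' ∈ Matrix.unitaryGroup κ ℂ)
    (hV' : V' ∈ Matrix.unitaryGroup κ ℂ) {s t : ι → ℝ} {s' t' : κ → ℝ} (hs : ∀ i, 0 ≤ s i)
    (ht : ∀ i, 0 ≤ t i) (hφ : N (unitaryDiag V t) = unitaryDiag V' t')
    (hσ : N (unitaryDiag U s) = unitaryDiag U' s') {T : ℝ} (hT : 0 < T) :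
    resolventForm (fun j i => Complex.normSq ((U'ᴴ * V') j i)) s' t' T ≤
      resolventForm (fun j i => Complex.normSq ((Uᴴ * V) j i)) s t T := by
  obtain ⟨Y, hY⟩ := exists_resolventFunctional_eq hU' hV' s' t' T
  obtain ⟨Z, hZ⟩ := exists_trace_dual N Y
  have hZ' : ∀ X, (X * Zᴴ).trace = (N X * Yᴴ).trace := by
    intro X
    have h := congrArg star (hZ Xᴴ)
    rwa [← Matrix.trace_conjTranspose, ← Matrix.trace_conjTranspose, Matrix.conjTranspose_mul,
      Matrix.conjTranspose_mul, hN.map_conjTranspose, Matrix.conjTranspose_conjTranspose,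
      Matrix.conjTranspose_conjTranspose, Matrix.trace_mul_comm, Matrix.trace_mul_comm Yᴴ] at h
  have h1 := hN.schwarz (posSemidef_unitaryDiag U hs) hZ
  have h2 := hN.schwarz (posSemidef_unitaryDiag V ht) hZ'
  rw [Matrix.conjTranspose_conjTranspose, Matrix.conjTranspose_conjTranspose] at h2
  rw [← hY]
  refine le_trans ?_ (resolventFunctional_le hU hV hs ht hT Z)
  rw [resolventFunctional, resolventFunctional, hZ, ← hφ, ← hσ]
  have := mul_le_mul_of_nonneg_left h2 hT.le
  linarith

/-- The primitive of the resolvent form in `T`. -/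
noncomputable def resolventPrimitive (w : ι → ι → ℝ) (s t : ι → ℝ) (T : ℝ) : ℝ :=
  ∑ j, ∑ i, w j i * (t i * Real.log (s j + T * t i))

omit [DecidableEq ι] in
theorem hasDerivAt_resolventPrimitive (w : ι → ι → ℝ) {s t : ι → ℝ} (hs : ∀ i, 0 ≤ s i)
    (ht : ∀ i, 0 ≤ t i) {T : ℝ} (hT : 0 < T) :
    HasDerivAt (resolventPrimitive w s t) (resolventForm w s t T) T := by
  unfold resolventPrimitive resolventForm
  refine HasDerivAt.fun_sum fun j _ => HasDerivAt.fun_sum fun i _ => ?_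
  refine HasDerivAt.const_mul _ ?_
  rcases (ht i).eq_or_lt with h | h
  · simpa [← h] using hasDerivAt_const T (0 : ℝ)
  · have hpos : s j + T * t i ≠ 0 := (add_pos_of_nonneg_of_pos (hs j) (mul_pos hT h)).ne'
    have h1 : HasDerivAt (fun T => s j + T * t i) (t i) T := by
      simpa using ((hasDerivAt_id T).mul_const (t i)).const_add (s j)
    simpa [mul_div_assoc] using (h1.log hpos).const_mul (t i)

-- Only T = 0 with s_j = 0 is critical for the logarithm, and there the support condition removes
-- the term.
omit [DecidableEq ι] in
theorem continuousOn_resolventPrimitive {w : ι → ι → ℝ} {s t : ι → ℝ} (hs : ∀ i, 0 ≤ s i)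
    (ht : ∀ i, 0 ≤ t i) (h : ∀ j i, s j = 0 → w j i * t i = 0) :
    ContinuousOn (resolventPrimitive w s t) (Set.Ici 0) := by
  unfold resolventPrimitive
  refine continuousOn_finsetSum _ fun j _ => continuousOn_finsetSum _ fun i _ => ?_
  simp only [← mul_assoc]
  rcases (hs j).eq_or_lt with h0 | h0
  · simp only [h j i h0.symm, zero_mul]
    exact continuousOn_const
  · refine continuousOn_const.mul (ContinuousOn.log (by fun_prop) fun T hT => ?_)
    exact (add_pos_of_pos_of_nonneg h0 (mul_nonneg hT (ht i))).ne'

-- Since the weights sum to one, log T can be subtracted inside the sum, leaving log(s_j/T + t_i).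
-- Thus -H(t), which is tr φ ln φ, appears at the upper end of the integral.
omit [DecidableEq ι] in
theorem tendsto_resolventPrimitive {w : ι → ι → ℝ} {s t : ι → ℝ}
    (hs : ∀ i, 0 ≤ s i) (ht : ∀ i, 0 ≤ t i) (hw : ∀ i, ∑ j, w j i = 1) (ht1 : ∑ i, t i = 1) :
    Tendsto (fun T => resolventPrimitive w s t T - Real.log T) atTop (𝓝 (-shannon t)) := by
  have hlim : Tendsto (fun T => ∑ j, ∑ i, w j i * (t i * Real.log (s j / T + t i))) atTop
      (𝓝 (∑ j, ∑ i, w j i * (t i * Real.log (t i)))) := by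
    refine tendsto_finsetSum _ fun j _ => tendsto_finsetSum _ fun i _ => ?_
    refine Tendsto.const_mul _ ?_
    rcases (ht i).eq_or_lt with h | h
    · simp [← h]
    · refine Tendsto.const_mul _ (Tendsto.log ?_ h.ne')
      simpa using (tendsto_const_nhds.div_atTop tendsto_id).add_const (t i)
  have hval : ∑ j, ∑ i, w j i * (t i * Real.log (t i)) = -shannon t := by
    rw [Finset.sum_comm, shannon, ← Finset.sum_neg_distrib]
    refine Finset.sum_congr rfl fun i _ => ?_
    rw [← Finset.sum_mul, hw, Real.negMulLog]
    ring
  rw [← hval]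
  refine hlim.congr' ?_
  filter_upwards [eventually_gt_atTop 0] with T hT
  have hlog : Real.log T = ∑ j, ∑ i, w j i * (t i * Real.log T) := by
    rw [Finset.sum_comm]
    simp only [← Finset.sum_mul, hw, one_mul, ht1]
  conv_rhs => rw [hlog]
  rw [resolventPrimitive]
  simp only [← Finset.sum_sub_distrib, ← mul_sub]
  refine Finset.sum_congr rfl fun j _ => Finset.sum_congr rfl fun i _ => ?_
  rcases (ht i).eq_or_lt with h | h
  · simp [← h]
  · have hpos : 0 < s j + T * t i := add_pos_of_nonneg_of_pos (hs j) (mul_pos hT h)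
    rw [← Real.log_div hpos.ne' hT.ne', add_div, mul_div_cancel_left₀ _ hT.ne']

omit [DecidableEq ι] in
/-- A resolvent form that stays bounded near zero forces the support condition. -/
theorem mul_eq_zero_of_resolventForm_le {w : ι → ι → ℝ} {s t : ι → ℝ} (hw : ∀ j i, 0 ≤ w j i)
    (hs : ∀ i, 0 ≤ s i) (ht : ∀ i, 0 ≤ t i) {C : ℝ}
    (hC : ∀ T, 0 < T → resolventForm w s t T ≤ C) {j i : ι} (hj : s j = 0) : w j i * t i = 0 := by
  by_contra hne
  have hpos : 0 < w j i * t i := lt_of_le_of_ne (mul_nonneg (hw j i) (ht i)) (Ne.symm hne)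
  have hti : t i ≠ 0 := right_ne_zero_of_mul hne
  have hle : ∀ T, 0 < T → w j i * t i / T ≤ C := by
    intro T hT
    refine le_trans ?_ (hC T hT)
    have hnn : ∀ j i, 0 ≤ w j i * (t i * t i / (s j + T * t i)) := fun j i =>
      mul_nonneg (hw j i) (div_nonneg (mul_self_nonneg _)
        (add_nonneg (hs j) (mul_nonneg hT.le (ht i))))
    have e : w j i * t i / T = w j i * (t i * t i / (s j + T * t i)) := by
      rw [hj, zero_add]
      field_simp
    rw [e]
    exact (Finset.single_le_sum (f := fun i => w j i * (t i * t i / (s j + T * t i)))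
      (fun i _ => hnn j i) (Finset.mem_univ i)).trans
      (Finset.single_le_sum (f := fun j => ∑ i, w j i * (t i * t i / (s j + T * t i)))
        (fun j _ => Finset.sum_nonneg fun i _ => hnn j i) (Finset.mem_univ j))
  have hCpos : 0 < C := lt_of_lt_of_le (by simpa using hpos) (hle 1 one_pos)
  -- At this T the lower bound equals 2C, which exceeds C.
  have h := hle (w j i * t i / (2 * C)) (div_pos hpos (by linarith))
  rw [div_div_eq_mul_div, mul_comm (w j i * t i), mul_div_assoc, div_self hpos.ne'] at h
  linarith

-- The bound is uniform in T. Combined with monotonicity of the form, it passes the support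
-- condition on to the output pair.
omit [DecidableEq ι] in
theorem resolventForm_le_of_support {w : ι → ι → ℝ} {s t : ι → ℝ} (hw : ∀ j i, 0 ≤ w j i)
    (hs : ∀ i, 0 ≤ s i) (ht : ∀ i, 0 ≤ t i) (h : ∀ j i, s j = 0 → w j i * t i = 0) {T : ℝ}
    (hT : 0 < T) : resolventForm w s t T ≤ ∑ j, ∑ i, w j i * (t i * t i / s j) := by
  refine Finset.sum_le_sum fun j _ => Finset.sum_le_sum fun i _ => ?_
  rcases (hs j).eq_or_lt with h0 | h0
  · rw [mul_div_assoc, ← mul_assoc, h j i h0.symm, mul_div_assoc, ← mul_assoc, h j i h0.symm]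
    simp
  · exact mul_le_mul_of_nonneg_left (div_le_div_of_nonneg_left (mul_self_nonneg _) h0
      (le_add_of_nonneg_right (mul_nonneg hT.le (ht i)))) (hw j i)

/-- The lower end of the integral is tr φ ln σ. -/
theorem resolventPrimitive_zero (U V : Matrix ι ι ℂ) (s t : ι → ℝ) :
    resolventPrimitive (fun j i => Complex.normSq ((Uᴴ * V) j i)) s t 0 =
      ∑ j, diagIn U (unitaryDiag V t) j * Real.log (s j) := by
  rw [resolventPrimitive]
  refine Finset.sum_congr rfl fun j _ => ?_
  rw [diagIn_unitaryDiag, Finset.sum_mul]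
  simp [mul_assoc]

/-- The data-processing inequality. -/
theorem relEntropy_map_le {N : Matrix ι ι ℂ →ₗ[ℂ] Matrix κ κ ℂ} (hN : IsChannel N)
    {φ σ : Matrix ι ι ℂ} (hφ : IsState φ) (hσ : IsState σ) :
    relEntropy (N φ) (N σ) ≤ relEntropy φ σ := by
  obtain ⟨V', hV', t', ht', ht1', hφ'⟩ := (hN.map_isState hφ).exists_eq_unitaryDiag
  obtain ⟨U', hU', s', hs', -, hσ'⟩ := (hN.map_isState hσ).exists_eq_unitaryDiag
  obtain ⟨V, hV, t, ht, ht1, rfl⟩ := hφ.exists_eq_unitaryDiag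
  obtain ⟨U, hU, s, hs, -, rfl⟩ := hσ.exists_eq_unitaryDiag
  by_cases hsupp : ∀ i, s i = 0 → diagIn U (unitaryDiag V t) i = 0
  swap
  · rw [relEntropy_unitaryDiag_of_not hU ht hsupp]
    exact le_top
  set w : ι → ι → ℝ := fun j i => Complex.normSq ((Uᴴ * V) j i) with hw
  set w' : κ → κ → ℝ := fun j i => Complex.normSq ((U'ᴴ * V') j i) with hw'
  have hw0 : ∀ j i, 0 ≤ w j i := fun _ _ => Complex.normSq_nonneg _
  have hw0' : ∀ j i, 0 ≤ w' j i := fun _ _ => Complex.normSq_nonneg _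
  have hle : ∀ T, 0 < T → resolventForm w' s' t' T ≤ resolventForm w s t T := fun T hT =>
    resolventForm_le_of_isChannel hN hU hV hU' hV' hs ht hφ' hσ' hT
  have hs0 : ∀ j i, s j = 0 → w j i * t i = 0 := fun j i hj => by
    have := hsupp j hj
    rw [diagIn_unitaryDiag] at this
    exact (Finset.sum_eq_zero_iff_of_nonneg fun i _ => mul_nonneg (hw0 j i) (ht i)).1 this i
      (Finset.mem_univ i)
  have hs0' : ∀ j i, s' j = 0 → w' j i * t' i = 0 := fun j i hj =>
    mul_eq_zero_of_resolventForm_le hw0' hs' ht' (fun T hT => (hle T hT).trans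
      (resolventForm_le_of_support hw0 hs ht hs0 hT)) hj
  have hsupp' : ∀ i, s' i = 0 → diagIn U' (unitaryDiag V' t') i = 0 := fun j hj => by
    rw [diagIn_unitaryDiag]
    exact Finset.sum_eq_zero fun i _ => hs0' j i hj
  rw [hφ', hσ', relEntropy_unitaryDiag hV' hU' ht' hsupp', relEntropy_unitaryDiag hV hU ht hsupp,
    EReal.coe_le_coe_iff]
  refine div_le_div_of_nonneg_right ?_ (Real.log_nonneg one_le_two)
  rw [← resolventPrimitive_zero, ← resolventPrimitive_zero, ← hw, ← hw']
  have hmono : MonotoneOn (fun T => resolventPrimitive w s t T - resolventPrimitive w' s' t' T)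
      (Set.Ici 0) := by
    have hder : ∀ T ∈ interior (Set.Ici (0 : ℝ)), HasDerivAt
        (fun T => resolventPrimitive w s t T - resolventPrimitive w' s' t' T)
        (resolventForm w s t T - resolventForm w' s' t' T) T := fun T hT => by
      rw [interior_Ici] at hT
      exact (hasDerivAt_resolventPrimitive w hs ht hT).sub
        (hasDerivAt_resolventPrimitive w' hs' ht' hT)
    refine monotoneOn_of_deriv_nonneg (convex_Ici 0)
      ((continuousOn_resolventPrimitive hs ht hs0).sub
        (continuousOn_resolventPrimitive hs' ht' hs0'))
      (fun T hT => (hder T hT).differentiableAt.differentiableWithinAt) fun T hT => ?_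
    rw [(hder T hT).deriv, sub_nonneg]
    rw [interior_Ici] at hT
    exact hle T hT
  -- The divergent log T is the same for both pairs and cancels in the difference, which is monotone
  -- in T.
  have hlim := (tendsto_resolventPrimitive (w := w) hs ht
    (sum_normSq_col (conjTranspose_mul_mem_unitaryGroup hU hV)) ht1).sub
    (tendsto_resolventPrimitive (w := w') hs' ht'
      (sum_normSq_col (conjTranspose_mul_mem_unitaryGroup hU' hV')) ht1')
  have := ge_of_tendsto hlim (b := resolventPrimitive w s t 0 - resolventPrimitive w' s' t' 0) (by
    filter_upwards [eventually_ge_atTop 0] with T hT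
    have := hmono (Set.self_mem_Ici) hT hT
    simp only at this
    linarith)
  linarith

end DataProcessing

/-! ### The trace norm -/

section TraceNorm

variable {ι : Type} [Fintype ι] [DecidableEq ι]

theorem traceNorm_unitaryDiag {U : Matrix ι ι ℂ} (hU : U ∈ Matrix.unitaryGroup ι ℂ) (s : ι → ℝ) :
    traceNorm (unitaryDiag U s) = ∑ i, |s i| := by
  have h : (unitaryDiag U s)ᴴ * unitaryDiag U s = unitaryDiag U fun i => s i ^ 2 := by
    rw [(isHermitian_unitaryDiag U s).eq]
    have := aeval_unitaryDiag hU s (Polynomial.X ^ 2)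
    simpa [pow_two] using this
  rw [traceNorm, h, cfc_unitaryDiag hU, trace_unitaryDiag hU, Complex.ofReal_re]
  simp only [Real.sqrt_sq_eq_abs]

theorem traceNorm_nonneg_of_isHermitian {X : Matrix ι ι ℂ} (hX : X.IsHermitian) :
    0 ≤ traceNorm X := by
  obtain ⟨V, hV, s, rfl⟩ := exists_eq_unitaryDiag hX
  rw [traceNorm_unitaryDiag hV]
  exact Finset.sum_nonneg fun _ _ => abs_nonneg _

/-- Doubly stochastic maps contract the ℓ¹ norm of the spectrum. -/
theorem sum_abs_diagIn_le_traceNorm {U X : Matrix ι ι ℂ} (hU : U ∈ Matrix.unitaryGroup ι ℂ)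
    (hX : X.IsHermitian) : ∑ i, |diagIn U X i| ≤ traceNorm X := by
  obtain ⟨V, hV, s, rfl⟩ := exists_eq_unitaryDiag hX
  rw [traceNorm_unitaryDiag hV]
  calc ∑ i, |diagIn U (unitaryDiag V s) i|
      ≤ ∑ i, ∑ j, Complex.normSq ((Uᴴ * V) i j) * |s j| := by
        refine Finset.sum_le_sum fun i _ => ?_
        rw [diagIn_unitaryDiag]
        refine (Finset.abs_sum_le_sum_abs _ _).trans_eq (Finset.sum_congr rfl fun j _ => ?_)
        rw [abs_mul, abs_of_nonneg (Complex.normSq_nonneg _)]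
    _ = ∑ j, |s j| := by
        rw [Finset.sum_comm]
        simp only [← Finset.sum_mul, sum_normSq_col (conjTranspose_mul_mem_unitaryGroup hU hV),
          one_mul]

theorem IsState.traceNorm_sub_le {φ ψ : Matrix ι ι ℂ} (hφ : IsState φ) (hψ : IsState ψ) :
    traceNorm (φ - ψ) ≤ 2 := by
  obtain ⟨V, hV, s, hs⟩ := _root_.exists_eq_unitaryDiag (hφ.1.1.sub hψ.1.1)
  have h : ∀ i, s i = diagIn V φ i - diagIn V ψ i := fun i => by
    rw [← diagIn_sub, hs, diagIn_unitaryDiag_self hV]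
  calc traceNorm (φ - ψ) = ∑ i, |diagIn V φ i - diagIn V ψ i| := by
        rw [hs, traceNorm_unitaryDiag hV]
        simp only [h]
    _ ≤ ∑ i, (diagIn V φ i + diagIn V ψ i) := by
        refine Finset.sum_le_sum fun i _ => abs_le.2 ?_
        have h1 := diagIn_nonneg hφ.1 V i
        have h2 := diagIn_nonneg hψ.1 V i
        constructor <;> linarith
    _ = 2 := by
        rw [Finset.sum_add_distrib, hφ.sum_diagIn hV, hψ.sum_diagIn hV]
        norm_num

theorem shannon_diagIn_sub_le {φ ψ U : Matrix ι ι ℂ} (hφ : IsState φ) (hψ : IsState ψ)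
    (hU : U ∈ Matrix.unitaryGroup ι ℂ) :
    shannon (diagIn U φ) - shannon (diagIn U ψ) ≤
      traceNorm (φ - ψ) / 2 * Real.log (Fintype.card ι) +
        Real.binEntropy (traceNorm (φ - ψ) / 2) := by
  refine shannon_sub_le (diagIn_nonneg hφ.1 U) (diagIn_nonneg hψ.1 U) (hφ.sum_diagIn hU)
    (hψ.sum_diagIn hU) ?_ (by linarith [hφ.traceNorm_sub_le hψ])
  have := sum_abs_diagIn_le_traceNorm hU (hφ.1.1.sub hψ.1.1)
  simp only [diagIn_sub] at this
  linarith

theorem traceNorm_sub_comm (X Y : Matrix ι ι ℂ) : traceNorm (X - Y) = traceNorm (Y - X) := by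
  rw [← neg_sub Y X, traceNorm, traceNorm, Matrix.conjTranspose_neg, neg_mul_neg]

/-- The von Neumann entropy in nats. -/
noncomputable def vnEntropy (φ : Matrix ι ι ℂ) : ℝ := -(φ * opLog φ).trace.re * Real.log 2

theorem vnEntropy_unitaryDiag {V : Matrix ι ι ℂ} (hV : V ∈ Matrix.unitaryGroup ι ℂ) (t : ι → ℝ) :
    vnEntropy (unitaryDiag V t) = shannon t := by
  have := (Real.log_pos one_lt_two).ne'
  rw [vnEntropy, trace_mul_opLog_self hV]
  field_simp

theorem IsState.vnEntropy_le {φ U : Matrix ι ι ℂ} (hφ : IsState φ)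
    (hU : U ∈ Matrix.unitaryGroup ι ℂ) : vnEntropy φ ≤ shannon (diagIn U φ) := by
  obtain ⟨V, hV, t, ht, -, rfl⟩ := hφ.exists_eq_unitaryDiag
  rw [vnEntropy_unitaryDiag hV]
  exact shannon_le_shannon_diagIn hU hV ht

/-- The Fannes–Audenaert inequality. -/
theorem vnEntropy_sub_le {φ ψ : Matrix ι ι ℂ} (hφ : IsState φ) (hψ : IsState ψ) :
    vnEntropy φ - vnEntropy ψ ≤ traceNorm (φ - ψ) / 2 * Real.log (Fintype.card ι) +
        Real.binEntropy (traceNorm (φ - ψ) / 2) := by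
  -- Dephasing in an eigenbasis of ψ keeps S(ψ) and does not lower S(φ), which reduces to the
  -- classical bound.
  obtain ⟨V, hV, t, ht, -, hψ'⟩ := hψ.exists_eq_unitaryDiag
  have h1 := shannon_diagIn_sub_le hφ hψ hV
  have h2 := hφ.vnEntropy_le hV
  have h3 : vnEntropy ψ = shannon (diagIn V ψ) := by
    rw [hψ', vnEntropy_unitaryDiag hV, diagIn_unitaryDiag_self hV]
  linarith

end TraceNorm

/-! ### Relative entropy of discord as a minimum over measurement bases -/

/-- The identification of `H^{⊗(m+n)}` with `H^{⊗m} ⊗ H^{⊗n}` on the level of product bases. -/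
def powAddEquiv (S : BipartiteSystem) (m n : ℕ) :
    (S.pow (m + n)).Idx ≃ (S.pow m).Idx × (S.pow n).Idx :=
  (Equiv.prodCongr (Fin.appendEquiv m n).symm (Fin.appendEquiv m n).symm).trans
    (Equiv.prodProdProdComm _ _ _ _)

/-- The operator `X ⊗ Y` on `H^{⊗(m+n)}`. -/
def joinOp {S : BipartiteSystem} {m n : ℕ} (X : Op (S.pow m)) (Y : Op (S.pow n)) :
    Op (S.pow (m + n)) :=
  (X ⊗ₖ Y).submatrix (powAddEquiv S m n) (powAddEquiv S m n)

/-- The sets of states `F` consist of the operators that are diagonal in one of the bases in `E`,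
a compact family of orthonormal bases that is stable under tensor products. -/
structure IsBasisFamily (F : StateFamily) (E : ∀ S : BipartiteSystem, Set (Op S)) : Prop where
  unitary : ∀ S, ∀ U ∈ E S, U ∈ Matrix.unitaryGroup S.Idx ℂ
  compact : ∀ S, IsCompact (E S)
  nonempty : ∀ S, (E S).Nonempty
  mem_iff : ∀ S ρ, ρ ∈ F S ↔
    ∃ U ∈ E S, ∃ s : S.Idx → ℝ, (∀ i, 0 ≤ s i) ∧ ∑ i, s i = 1 ∧ ρ = unitaryDiag U s
  join_mem : ∀ (S : BipartiteSystem) (m n : ℕ), ∀ U ∈ E (S.pow m), ∀ V ∈ E (S.pow n),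
    joinOp U V ∈ E (S.pow (m + n))

namespace IsBasisFamily

variable {F : StateFamily} {E : ∀ S : BipartiteSystem, Set (Op S)} (h : IsBasisFamily F E)
  {S : BipartiteSystem} {φ ψ : Op S}

include h

theorem isState_of_mem {σ : Op S} (hσ : σ ∈ F S) : IsState σ := by
  obtain ⟨U, hU, s, hs, hs1, rfl⟩ := (h.mem_iff S σ).1 hσ
  exact isState_unitaryDiag (h.unitary S U hU) hs hs1

/-- Within one basis the optimum is the dephased state, by Gibbs; the remaining minimization is of a
continuous function on a compact set. -/
theorem exists_isLeast (hφ : IsState φ) : ∃ U ∈ E S,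
    (∀ U' ∈ E S, shannon (diagIn U φ) ≤ shannon (diagIn U' φ)) ∧
    IsLeast (relEntropy φ '' F S)
      (((shannon (diagIn U φ) - vnEntropy φ) / Real.log 2 : ℝ) : EReal) := by
  have hcont : Continuous fun U : Op S => shannon (diagIn U φ) := by
    refine continuous_shannon.comp (continuous_pi fun i => ?_)
    unfold diagIn
    have h1 : Continuous fun U : Op S => Uᴴ * φ * U :=
      ((continuous_id.matrix_conjTranspose).matrix_mul continuous_const).matrix_mul continuous_id
    exact Complex.continuous_re.comp (h1.matrix_elem i i)
  obtain ⟨U, hU, hmin⟩ := (h.compact S).exists_isMinOn (h.nonempty S) hcont.continuousOn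
  refine ⟨U, hU, hmin, ?_, ?_⟩
  · refine ⟨unitaryDiag U (diagIn U φ), (h.mem_iff S _).2 ⟨U, hU, _, diagIn_nonneg hφ.1 U,
      hφ.sum_diagIn (h.unitary S U hU), rfl⟩, ?_⟩
    obtain ⟨V, hV, t, ht, -, rfl⟩ := hφ.exists_eq_unitaryDiag
    rw [relEntropy_unitaryDiag hV (h.unitary S U hU) ht fun i hi => hi, vnEntropy_unitaryDiag hV]
    congr 2
    simp only [shannon, Real.negMulLog, neg_mul, Finset.sum_neg_distrib]
    ring
  · rintro _ ⟨σ, hσ, rfl⟩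
    obtain ⟨U', hU', s, hs, hs1, rfl⟩ := (h.mem_iff S σ).1 hσ
    have hle := hmin hU'
    have hr1 := hφ.sum_diagIn (h.unitary S U' hU')
    have hr := diagIn_nonneg hφ.1 U'
    obtain ⟨V, hV, t, ht, -, rfl⟩ := hφ.exists_eq_unitaryDiag
    by_cases hsupp : ∀ i, s i = 0 → diagIn U' (unitaryDiag V t) i = 0
    · rw [relEntropy_unitaryDiag hV (h.unitary S U' hU') ht hsupp, EReal.coe_le_coe_iff,
        vnEntropy_unitaryDiag hV]
      refine div_le_div_of_nonneg_right ?_ (Real.log_nonneg one_le_two)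
      have := shannon_le_neg_sum_mul_log hr hs (hs1.trans hr1.symm) hsupp
      have hle' : shannon (diagIn U (unitaryDiag V t)) ≤ shannon (diagIn U' (unitaryDiag V t)) :=
        hle
      linarith
    · rw [relEntropy_unitaryDiag_of_not (h.unitary S U' hU') ht hsupp]
      exact le_top

theorem exists_relDiscord_eq (hφ : IsState φ) : ∃ U ∈ E S,
    relDiscord F S φ = (shannon (diagIn U φ) - vnEntropy φ) / Real.log 2 := by
  obtain ⟨U, hU, -, hleast⟩ := h.exists_isLeast hφ
  exact ⟨U, hU, by rw [relDiscord, hleast.isGLB.sInf_eq, EReal.toReal_coe]⟩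

theorem relDiscord_le (hφ : IsState φ) {U : Op S} (hU : U ∈ E S) :
    relDiscord F S φ ≤ (shannon (diagIn U φ) - vnEntropy φ) / Real.log 2 := by
  obtain ⟨V, -, hmin, hleast⟩ := h.exists_isLeast hφ
  rw [relDiscord, hleast.isGLB.sInf_eq, EReal.toReal_coe]
  exact div_le_div_of_nonneg_right (sub_le_sub_right (hmin U hU) _) (Real.log_nonneg one_le_two)

theorem isLeast_relDiscord (hφ : IsState φ) :
    IsLeast (relEntropy φ '' F S) ((relDiscord F S φ : ℝ) : EReal) := by
  obtain ⟨V, -, -, hleast⟩ := h.exists_isLeast hφ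
  rwa [relDiscord, hleast.isGLB.sInf_eq, EReal.toReal_coe]

theorem relDiscord_nonneg (hφ : IsState φ) : 0 ≤ relDiscord F S φ := by
  obtain ⟨U, hU, e⟩ := h.exists_relDiscord_eq hφ
  rw [e]
  exact div_nonneg (sub_nonneg.2 (hφ.vnEntropy_le (h.unitary S U hU)))
    (Real.log_nonneg one_le_two)

/-- The optimal basis of ψ is a trial basis for φ. The two Fannes–Audenaert bounds at half the trace
norm account for the full norm and the factor 2. -/
theorem relDiscord_sub_le (hφ : IsState φ) (hψ : IsState ψ) :
    relDiscord F S φ - relDiscord F S ψ ≤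
      traceNorm (φ - ψ) * Real.logb 2 S.dim + 2 * h₂ (traceNorm (φ - ψ) / 2) := by
  obtain ⟨U, hU, e⟩ := h.exists_relDiscord_eq hψ
  have h1 := h.relDiscord_le hφ hU
  have h2 := shannon_diagIn_sub_le hφ hψ (h.unitary S U hU)
  have h3 := vnEntropy_sub_le hψ hφ
  rw [traceNorm_sub_comm ψ φ] at h3
  have hd : Fintype.card S.Idx = S.dim := Fintype.card_prod _ _
  rw [hd] at h2 h3
  have hlog := Real.log_pos one_lt_two
  calc relDiscord F S φ - relDiscord F S ψ
      ≤ ((shannon (diagIn U φ) - shannon (diagIn U ψ)) + (vnEntropy ψ - vnEntropy φ)) /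
          Real.log 2 := by
        rw [e]
        refine (sub_le_sub_right h1 _).trans_eq ?_
        rw [← sub_div]
        congr 1
        ring
    _ ≤ (traceNorm (φ - ψ) * Real.log S.dim +
          2 * Real.binEntropy (traceNorm (φ - ψ) / 2)) / Real.log 2 :=
        div_le_div_of_nonneg_right (by linarith) hlog.le
    _ = _ := by
        rw [h₂_eq, Real.logb]
        ring

theorem abs_relDiscord_sub_le (hφ : IsState φ) (hψ : IsState ψ) :
    |relDiscord F S φ - relDiscord F S ψ| ≤
      traceNorm (φ - ψ) * Real.logb 2 S.dim + 2 * h₂ (traceNorm (φ - ψ) / 2) := by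
  have h1 := h.relDiscord_sub_le hφ hψ
  have h2 := h.relDiscord_sub_le hψ hφ
  rw [traceNorm_sub_comm ψ φ] at h2
  exact abs_le.2 ⟨by linarith, h1⟩

/-- Monotonicity of the relative entropy of discord under free operations. -/
theorem relDiscord_map_le {T : BipartiteSystem} {N : Op S →ₗ[ℂ] Op T} (hN : IsChannel N)
    (hfree : ∀ σ ∈ F S, N σ ∈ F T) (hφ : IsState φ) :
    relDiscord F T (N φ) ≤ relDiscord F S φ := by
  obtain ⟨σ, hσ, e⟩ := (h.isLeast_relDiscord hφ).1
  rw [← EReal.coe_le_coe_iff, ← e]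
  exact ((h.isLeast_relDiscord (hN.map_isState hφ)).2 ⟨N σ, hfree σ hσ, rfl⟩).trans
    (relEntropy_map_le hN hφ (h.isState_of_mem hσ))

end IsBasisFamily

/-! ### Tensor powers -/

section TensorPowers

variable {S T : BipartiteSystem}

theorem trace_submatrix_equiv {ι κ : Type} [Fintype ι] [Fintype κ] (X : Matrix ι ι ℂ)
    (e : κ ≃ ι) : (X.submatrix e e).trace = X.trace :=
  Equiv.sum_comp e fun i => X i i

theorem joinOp_apply {m n : ℕ} (X : Op (S.pow m)) (Y : Op (S.pow n)) (x y : (S.pow (m + n)).Idx) :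
    joinOp X Y x y = X (powAddEquiv S m n x).1 (powAddEquiv S m n y).1 *
      Y (powAddEquiv S m n x).2 (powAddEquiv S m n y).2 := rfl

theorem joinOp_mul {m n : ℕ} (X X' : Op (S.pow m)) (Y Y' : Op (S.pow n)) :
    joinOp X Y * joinOp X' Y' = joinOp (X * X') (Y * Y') := by
  simp only [joinOp, Matrix.mul_kronecker_mul, Matrix.submatrix_mul_equiv]

theorem conjTranspose_joinOp {m n : ℕ} (X : Op (S.pow m)) (Y : Op (S.pow n)) :
    (joinOp X Y)ᴴ = joinOp Xᴴ Yᴴ := by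
  simp only [joinOp, Matrix.conjTranspose_submatrix, Matrix.conjTranspose_kronecker]

theorem isState_joinOp {m n : ℕ} {X : Op (S.pow m)} {Y : Op (S.pow n)} (hX : IsState X)
    (hY : IsState Y) : IsState (joinOp X Y) := by
  refine ⟨(hX.1.kronecker hY.1).submatrix _, ?_⟩
  rw [joinOp, trace_submatrix_equiv, Matrix.trace_kronecker, hX.2, hY.2, one_mul]

theorem joinOp_mem_unitaryGroup {m n : ℕ} {U : Op (S.pow m)} {V : Op (S.pow n)}
    (hU : U ∈ Matrix.unitaryGroup (S.pow m).Idx ℂ) (hV : V ∈ Matrix.unitaryGroup (S.pow n).Idx ℂ) :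
    joinOp U V ∈ Matrix.unitaryGroup (S.pow (m + n)).Idx ℂ := by
  rw [Matrix.mem_unitaryGroup_iff, Matrix.star_eq_conjTranspose, conjTranspose_joinOp, joinOp_mul,
    mul_conjTranspose_self_of_mem_unitaryGroup hU, mul_conjTranspose_self_of_mem_unitaryGroup hV,
    joinOp, Matrix.one_kronecker_one, Matrix.submatrix_one_equiv]

theorem unitaryDiag_joinOp {m n : ℕ} (U : Op (S.pow m)) (V : Op (S.pow n))
    (s : (S.pow m).Idx → ℝ) (t : (S.pow n).Idx → ℝ) :
    unitaryDiag (joinOp U V) (fun x => s (powAddEquiv S m n x).1 * t (powAddEquiv S m n x).2) =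
      joinOp (unitaryDiag U s) (unitaryDiag V t) := by
  have h : (Matrix.diagonal fun x => ((s (powAddEquiv S m n x).1 * t (powAddEquiv S m n x).2 : ℝ) :
      ℂ)) = joinOp (Matrix.diagonal fun i => (s i : ℂ)) (Matrix.diagonal fun i => (t i : ℂ)) := by
    rw [joinOp, Matrix.diagonal_kronecker_diagonal, Matrix.submatrix_diagonal_equiv]
    congr 1
    ext x
    simp
  rw [unitaryDiag, h, conjTranspose_joinOp, joinOp_mul, joinOp_mul]
  rfl

theorem diagIn_joinOp {m n : ℕ} (U : Op (S.pow m)) (V : Op (S.pow n)) {X : Op (S.pow m)}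
    {Y : Op (S.pow n)} (hX : X.IsHermitian) :
    diagIn (joinOp U V) (joinOp X Y) = (fun x : (S.pow m).Idx × (S.pow n).Idx =>
      diagIn U X x.1 * diagIn V Y x.2) ∘ powAddEquiv S m n := by
  ext x
  -- `diagIn` takes real parts, which multiply as soon as one factor is real.
  have h : ((Uᴴ * X * U) (powAddEquiv S m n x).1 (powAddEquiv S m n x).1).im = 0 := by
    have := (Matrix.isHermitian_conjTranspose_mul_mul U hX).apply (powAddEquiv S m n x).1
      (powAddEquiv S m n x).1
    exact Complex.conj_eq_iff_im.1 this
  rw [diagIn, conjTranspose_joinOp, joinOp_mul, joinOp_mul, joinOp_apply, Complex.mul_re, h,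
    zero_mul, sub_zero]
  rfl

theorem shannon_diagIn_joinOp {m n : ℕ} {U X : Op (S.pow m)} {V Y : Op (S.pow n)}
    (hU : U ∈ Matrix.unitaryGroup (S.pow m).Idx ℂ) (hV : V ∈ Matrix.unitaryGroup (S.pow n).Idx ℂ)
    (hX : IsState X) (hY : IsState Y) :
    shannon (diagIn (joinOp U V) (joinOp X Y)) = shannon (diagIn U X) + shannon (diagIn V Y) := by
  rw [diagIn_joinOp U V hX.1.1, shannon_comp_equiv,
    shannon_mul (hX.sum_diagIn hU) (hY.sum_diagIn hV)]

theorem vnEntropy_joinOp {m n : ℕ} {X : Op (S.pow m)} {Y : Op (S.pow n)} (hX : IsState X)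
    (hY : IsState Y) : vnEntropy (joinOp X Y) = vnEntropy X + vnEntropy Y := by
  obtain ⟨U, hU, s, -, hs, rfl⟩ := hX.exists_eq_unitaryDiag
  obtain ⟨V, hV, t, -, ht, rfl⟩ := hY.exists_eq_unitaryDiag
  rw [← unitaryDiag_joinOp, vnEntropy_unitaryDiag (joinOp_mem_unitaryGroup hU hV),
    vnEntropy_unitaryDiag hU, vnEntropy_unitaryDiag hV, ← shannon_mul hs ht]
  exact shannon_comp_equiv (powAddEquiv S m n)
    fun x : (S.pow m).Idx × (S.pow n).Idx => s x.1 * t x.2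

theorem tensorPow_add (φ : Op S) (m n : ℕ) :
    tensorPow φ (m + n) = joinOp (tensorPow φ m) (tensorPow φ n) := by
  ext x y
  rw [joinOp_apply]
  simp only [tensorPow, tensorProd]
  exact Fin.prod_univ_add _

theorem IsState.tensorPow {φ : Op S} (hφ : IsState φ) (n : ℕ) : IsState (tensorPow φ n) := by
  induction n with
  | zero =>
    have h : _root_.tensorPow φ 0 = (1 : Op (S.pow 0)) := by
      ext x y
      obtain rfl : x = y := Prod.ext (Subsingleton.elim (α := Fin 0 → S.A) _ _)
        (Subsingleton.elim (α := Fin 0 → S.B) _ _)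
      simp [_root_.tensorPow, tensorProd]
      rfl
    rw [h]
    refine ⟨Matrix.PosSemidef.one, ?_⟩
    rw [Matrix.trace_one]
    have : Fintype.card (S.pow 0).Idx = 1 := by
      rw [Fintype.card_prod]
      change Fintype.card (Fin 0 → S.A) * Fintype.card (Fin 0 → S.B) = 1
      simp
    rw [this, Nat.cast_one]
  | succ n ih =>
    rw [tensorPow_add]
    refine isState_joinOp ih ?_
    let e : (S.pow 1).Idx ≃ S.Idx :=
      Equiv.prodCongr (Equiv.funUnique (Fin 1) S.A) (Equiv.funUnique (Fin 1) S.B)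
    have h : _root_.tensorPow φ 1 = φ.submatrix e e := by
      ext x y
      simp only [_root_.tensorPow, tensorProd, Finset.univ_unique, Finset.prod_singleton]
      rfl
    rw [h]
    exact ⟨hφ.1.submatrix _, by rw [trace_submatrix_equiv, hφ.2]⟩

theorem pow_dim (S : BipartiteSystem) (n : ℕ) : (S.pow n).dim = S.dim ^ n := by
  change Fintype.card (Fin n → S.A) * Fintype.card (Fin n → S.B) = _
  simp [BipartiteSystem.dim, mul_pow]

/-- The tensor power `N^{⊗n}` of a linear map exists. -/
theorem exists_isTensorPowOf (N : Op S →ₗ[ℂ] Op T) (n : ℕ) :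
    ∃ L : Op (S.pow n) →ₗ[ℂ] Op (T.pow n), IsTensorPowOf N n L := by
  -- The matrix entries of ⊗ᵢ N(E_{uᵢvᵢ}), the prescribed image of a product of matrix units.
  let c (u v : (S.pow n).Idx) (x y : (T.pow n).Idx) : ℂ :=
    ∏ i, N (Matrix.single (u.1 i, u.2 i) (v.1 i, v.2 i) 1) (x.1 i, x.2 i) (y.1 i, y.2 i)
  refine ⟨{
    toFun := fun X => Matrix.of fun x y => ∑ u, ∑ v, X u v * c u v x y
    map_add' := fun X Y => by
      ext x y
      simp [add_mul, Finset.sum_add_distrib]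
    map_smul' := fun a X => by
      ext x y
      simp [Finset.mul_sum, mul_assoc] }, fun X => ?_⟩
  ext x y
  have hN : ∀ i, N (X i) (x.1 i, x.2 i) (y.1 i, y.2 i) =
      ∑ a, ∑ b, X i a b * N (Matrix.single a b 1) (x.1 i, x.2 i) (y.1 i, y.2 i) := by
    intro i
    conv_lhs => rw [Matrix.matrix_eq_sum_single (X i)]
    simp only [map_sum, Matrix.sum_apply]
    refine Finset.sum_congr rfl fun a _ => Finset.sum_congr rfl fun b _ => ?_
    rw [← mul_one (X i a b), ← smul_eq_mul, ← Matrix.smul_single, map_smul, Matrix.smul_apply,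
      smul_eq_mul, smul_eq_mul, mul_one]
  let e : (Fin n → S.Idx) ≃ (S.pow n).Idx := Equiv.arrowProdEquivProdArrow _ _ _
  change ∑ u, ∑ v, tensorProd X u v * c u v x y =
    ∏ i, N (X i) (x.1 i, x.2 i) (y.1 i, y.2 i)
  simp only [hN]
  rw [Finset.prod_univ_sum, Fintype.piFinset_univ, ← e.sum_comp]
  refine Finset.sum_congr rfl fun u _ => ?_
  rw [Finset.prod_univ_sum, Fintype.piFinset_univ, ← e.sum_comp]
  refine Finset.sum_congr rfl fun v _ => ?_
  rw [Finset.prod_mul_distrib]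
  rfl

end TensorPowers

/-! ### Regularization and consistency -/

theorem tendsto_h₂_zero : Tendsto h₂ (𝓝 0) (𝓝 0) := by
  have h : h₂ = fun x => Real.binEntropy x / Real.log 2 := funext h₂_eq
  have hc : Continuous h₂ := by
    rw [h]
    exact Real.binEntropy_continuous.div_const _
  simpa [h₂_eq] using hc.tendsto 0

theorem h₂_le_one (x : ℝ) : h₂ x ≤ 1 := by
  rw [h₂_eq, div_le_one (Real.log_pos one_lt_two)]
  exact Real.binEntropy_le_log_two

theorem h₂_nonneg {x : ℝ} (h0 : 0 ≤ x) (h1 : x ≤ 1) : 0 ≤ h₂ x := by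
  rw [h₂_eq]
  exact div_nonneg (Real.binEntropy_nonneg h0 h1) (Real.log_nonneg one_le_two)

namespace IsBasisFamily

variable {F : StateFamily} {E : ∀ S : BipartiteSystem, Set (Op S)} (h : IsBasisFamily F E)
  {S T : BipartiteSystem} {φ : Op S} {ψ : Op T}

include h

theorem isAsymptoticallyContinuous : IsAsymptoticallyContinuous (relDiscord F) := by
  intro S n φ ψ hn hφ hψ hlim
  have hT0 : ∀ i, 0 ≤ traceNorm (φ i - ψ i) := fun i =>
    traceNorm_nonneg_of_isHermitian ((hφ i).1.1.sub (hψ i).1.1)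
  have hbound : Tendsto (fun i => traceNorm (φ i - ψ i) * Real.logb 2 S.dim +
      2 * h₂ (traceNorm (φ i - ψ i) / 2)) atTop (𝓝 0) := by
    have h1 : Tendsto (fun i => traceNorm (φ i - ψ i) / 2) atTop (𝓝 0) := by
      simpa using hlim.div_const 2
    simpa using (hlim.mul_const (Real.logb 2 S.dim)).add
      ((tendsto_h₂_zero.comp h1).const_mul 2)
  refine squeeze_zero (fun i => by positivity) (fun i => ?_) hbound
  have hni : (1 : ℝ) ≤ n i := by exact_mod_cast hn i
  have hb := h.abs_relDiscord_sub_le (hφ i) (hψ i)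
  rw [pow_dim, Nat.cast_pow, Real.logb_pow] at hb
  rw [div_le_iff₀ (by linarith)]
  -- The dimension term scales with n; the entropy term does not, but being nonnegative it is at
  -- most n times itself.
  have h2 := h₂_nonneg (x := traceNorm (φ i - ψ i) / 2) (by linarith [hT0 i])
    (by linarith [(hφ i).traceNorm_sub_le (hψ i)])
  nlinarith [mul_nonneg h2 (sub_nonneg.2 hni)]

/-- The product of two optimal bases is admissible, and both entropies are additive on products. -/
theorem subadditive_relDiscord_tensorPow (hφ : IsState φ) :
    Subadditive fun n => relDiscord F (S.pow n) (tensorPow φ n) := by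
  intro m n
  obtain ⟨U, hU, eU⟩ := h.exists_relDiscord_eq (hφ.tensorPow m)
  obtain ⟨V, hV, eV⟩ := h.exists_relDiscord_eq (hφ.tensorPow n)
  have hle := h.relDiscord_le (hφ.tensorPow (m + n)) (h.join_mem S m n U hU V hV)
  beta_reduce
  rw [eU, eV, ← add_div]
  refine hle.trans_eq ?_
  rw [tensorPow_add, shannon_diagIn_joinOp (h.unitary _ U hU) (h.unitary _ V hV)
    (hφ.tensorPow m) (hφ.tensorPow n), vnEntropy_joinOp (hφ.tensorPow m) (hφ.tensorPow n)]
  ring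

theorem tendsto_regularization (hφ : IsState φ) :
    Tendsto (fun n : ℕ => relDiscord F (S.pow n) (tensorPow φ n) / n) atTop
      (𝓝 (regularization (relDiscord F) S φ)) := by
  have hlim := (h.subadditive_relDiscord_tensorPow hφ).tendsto_lim ⟨0, by
    rintro _ ⟨n, rfl⟩
    exact div_nonneg (h.relDiscord_nonneg (hφ.tensorPow n)) n.cast_nonneg⟩
  rw [regularization, hlim.limUnder_eq]
  exact hlim

theorem regularization_nonneg (hφ : IsState φ) : 0 ≤ regularization (relDiscord F) S φ :=
  ge_of_tendsto' (h.tendsto_regularization hφ) fun n =>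
    div_nonneg (h.relDiscord_nonneg (hφ.tensorPow n)) n.cast_nonneg

/-- The regularized relative entropy of discord bounds every achievable rate. -/
theorem mul_regularization_le {O : OperationClass} (hO : O.Preserves F) (hφ : IsState φ)
    (hψ : IsState ψ) {r : ℝ≥0} (hr : IsAchievable O φ ψ r) :
    (r : ℝ) * regularization (relDiscord F) T ψ ≤ regularization (relDiscord F) S φ := by
  -- For r = 0 the number of target copies would not tend to infinity.
  rcases eq_zero_or_pos r with rfl | hrpos
  · simpa using h.regularization_nonneg hφ
  have hr0 : (0 : ℝ) < r := hrpos
  obtain ⟨N, hN, hliminf⟩ := hr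
  set m : ℕ → ℕ := fun n => ⌈(r : ℝ) * n⌉₊ with hm
  set a : ℕ → ℝ := fun n => traceNorm (N n (tensorPow φ n) - tensorPow ψ (m n)) with ha
  have hstate : ∀ n, IsState (N n (tensorPow φ n)) := fun n =>
    (hO _ _ _ (hN n)).1.map_isState (hφ.tensorPow n)
  have ha0 : ∀ n, 0 ≤ a n := fun n =>
    traceNorm_nonneg_of_isHermitian ((hstate n).1.1.sub (hψ.tensorPow _).1.1)
  have ha2 : ∀ n, a n ≤ 2 := fun n => (hstate n).traceNorm_sub_le (hψ.tensorPow _)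
  have hmlim : Tendsto (fun n : ℕ => (m n : ℝ) / n) atTop (𝓝 r) :=
    (tendsto_nat_ceil_mul_div_atTop hr0.le).comp tendsto_natCast_atTop_atTop
  have hmtop : Tendsto m atTop atTop :=
    tendsto_nat_ceil_atTop.comp (tendsto_natCast_atTop_atTop.const_mul_atTop hr0)
  set L := Real.logb 2 T.dim with hL
  have hL0 : 0 ≤ L := by
    rw [hL, Real.logb]
    exact div_nonneg (Real.log_natCast_nonneg _) (Real.log_nonneg one_le_two)
  have hstep : ∀ n, relDiscord F (T.pow (m n)) (tensorPow ψ (m n)) ≤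
      relDiscord F (S.pow n) (tensorPow φ n) + a n * (m n * L) + 2 := by
    intro n
    have h1 := h.relDiscord_map_le (hO _ _ _ (hN n)).1 (hO _ _ _ (hN n)).2 (hφ.tensorPow n)
    have h2 := h.relDiscord_sub_le (hψ.tensorPow (m n)) (hstate n)
    rw [traceNorm_sub_comm, pow_dim, Nat.cast_pow, Real.logb_pow] at h2
    have h3 := h₂_le_one (a n / 2)
    simp only [ha] at h3 ⊢
    linarith
  have hdiff : Tendsto (fun n : ℕ => relDiscord F (T.pow (m n)) (tensorPow ψ (m n)) / n -
      relDiscord F (S.pow n) (tensorPow φ n) / n) atTop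
      (𝓝 (r * regularization (relDiscord F) T ψ - regularization (relDiscord F) S φ)) := by
    refine Tendsto.sub ?_ (h.tendsto_regularization hφ)
    refine (hmlim.mul ((h.tendsto_regularization hψ).comp hmtop)).congr' ?_
    filter_upwards [hmtop.eventually_gt_atTop 0] with n hn
    have : (m n : ℝ) ≠ 0 := by exact_mod_cast hn.ne'
    simp only [Function.comp_apply]
    field_simp
  by_contra! hlt
  set η := r * regularization (relDiscord F) T ψ - regularization (relDiscord F) S φ with hη
  have hηpos : 0 < η := sub_pos.2 hlt
  -- Chosen so that the continuity error per copy is at most η/4 once m/n < r + 1; the added 1 keeps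
  -- the denominator positive when L = 0.
  set δ := η / (4 * ((r + 1) * L + 1)) with hδ
  have hden : 0 < 4 * ((r + 1) * L + 1) := by positivity
  have hδpos : 0 < δ := div_pos hηpos hden
  -- The liminf gives accuracy only frequently. This suffices, since the other conditions hold
  -- eventually.
  have hfreq : ∃ᶠ n in atTop, a n < δ := by
    refine frequently_lt_of_liminf_lt ?_ (by rw [hliminf]; exact hδpos)
    exact (isBoundedUnder_of ⟨2, ha2⟩ : IsBoundedUnder (· ≤ ·) atTop a).isCoboundedUnder_ge
  have hev1 : ∀ᶠ n : ℕ in atTop, (m n : ℝ) / n < r + 1 :=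
    hmlim.eventually_lt_const (by linarith)
  have hev2 : ∀ᶠ n : ℕ in atTop, (2 : ℝ) / n < η / 4 :=
    (tendsto_const_div_atTop_nhds_zero_nat (2 : ℝ)).eventually_lt_const (by linarith)
  have hev3 := hdiff.eventually_const_lt (u := η / 2) (by linarith)
  obtain ⟨n, hna, hn1, hn2, hn3, hnpos⟩ :=
    (hfreq.and_eventually (hev1.and (hev2.and (hev3.and (eventually_gt_atTop 0))))).exists
  have hn0 : (0 : ℝ) < n := by exact_mod_cast hnpos
  have h1 := div_le_div_of_nonneg_right (hstep n) hn0.le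
  have h2 : a n * (m n * L) / n ≤ η / 4 := by
    calc a n * (m n * L) / n = a n * ((m n / n) * L) := by ring
      _ ≤ δ * ((r + 1) * L + 1) := by
          refine mul_le_mul hna.le ?_ (by positivity) hδpos.le
          have := mul_le_mul_of_nonneg_right hn1.le hL0
          linarith
      _ = η / 4 := by
          rw [hδ]
          field_simp
  rw [add_div, add_div] at h1
  linarith

theorem isConsistent {O : OperationClass} (hO : O.Preserves F) :
    IsConsistent O (regularization (relDiscord F)) := by
  intro S T φ ψ hφ hψ
  have hx := h.regularization_nonneg hψ
  have hy := h.regularization_nonneg hφ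
  have hrate := fun (r : ℝ≥0) (hr : IsAchievable O φ ψ r) => h.mul_regularization_le hO hφ hψ hr
  generalize regularization (relDiscord F) T ψ = x at *
  generalize regularization (relDiscord F) S φ = y at *
  -- If the measure of ψ vanishes the rate may be infinite, and 0 · ∞ = 0 applies.
  rcases hx.eq_or_lt with rfl | hx
  · simpa using hy
  have hle : conversionRate O φ ψ ≤ ENNReal.ofReal (y / x) := by
    refine iSup₂_le fun r hr => ?_
    rw [← ENNReal.ofReal_coe_nnreal]
    exact ENNReal.ofReal_le_ofReal ((le_div_iff₀ hx).2 (hrate r hr))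
  calc (x : EReal) * (conversionRate O φ ψ : EReal)
      ≤ (x : EReal) * ((ENNReal.ofReal (y / x) : ℝ≥0∞) : EReal) :=
        mul_le_mul_of_nonneg_left (EReal.coe_ennreal_le_coe_ennreal_iff.2 hle)
          (EReal.coe_nonneg.2 hx.le)
    _ = y := by
        rw [EReal.coe_ennreal_ofReal, max_eq_left (div_nonneg hy hx.le), ← EReal.coe_mul,
          mul_div_cancel₀ _ hx.ne']

theorem isMonotone {O : OperationClass} (hO : O.Preserves F) : IsMonotone O (relDiscord F) :=
  fun S T N hN _ hφ => h.relDiscord_map_le (hO S T N hN).1 (hO S T N hN).2 hφ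

theorem isMonotone_regularization {O : OperationClass} (hO : O.Preserves F)
    (hpow : O.ClosedUnderTensorPowers) : IsMonotone O (regularization (relDiscord F)) := by
  intro S T N hN φ hφ
  refine le_of_tendsto_of_tendsto' (h.tendsto_regularization ((hO S T N hN).1.map_isState hφ))
    (h.tendsto_regularization hφ) fun n => ?_
  obtain ⟨L, hL⟩ := exists_isTensorPowOf N n
  have hLO := hpow S T N hN n L hL
  have e : tensorPow (N φ) n = L (tensorPow φ n) := (hL fun _ => φ).symm
  rw [e]
  exact div_le_div_of_nonneg_right (h.relDiscord_map_le (hO _ _ L hLO).1 (hO _ _ L hLO).2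
    (hφ.tensorPow n)) n.cast_nonneg

end IsBasisFamily

/-! ### The bases of quantum-classical and classical-quantum states -/

section Bases

theorem isCompact_unitaryGroup (ι : Type) [Fintype ι] [DecidableEq ι] :
    IsCompact (Matrix.unitaryGroup ι ℂ : Set (Matrix ι ι ℂ)) := by
  have hsub : (Matrix.unitaryGroup ι ℂ : Set (Matrix ι ι ℂ)) ⊆
      Set.univ.pi fun _ => Set.univ.pi fun _ => Metric.closedBall (0 : ℂ) 1 :=
    fun U hU i _ j _ => by simpa using entry_norm_bound_of_unitary hU i j
  refine IsCompact.of_isClosed_subset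
    (isCompact_univ_pi fun _ => isCompact_univ_pi fun _ => isCompact_closedBall _ _) ?_ hsub
  have h : (Matrix.unitaryGroup ι ℂ : Set (Matrix ι ι ℂ)) = {U | U * Uᴴ = 1} := by
    ext U
    exact Matrix.mem_unitaryGroup_iff
  rw [h]
  exact isClosed_eq (continuous_id.matrix_mul continuous_id.matrix_conjTranspose) continuous_const

variable {α β : Type} [Fintype α] [DecidableEq α] [Fintype β] [DecidableEq β]

/-- The matrix whose columns are the vectors `aₖ(j) ⊗ b(k)`. -/
def conditionalBasis (b : Matrix β β ℂ) (a : β → Matrix α α ℂ) : Matrix (α × β) (α × β) ℂ :=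
  Matrix.of fun x y => a y.2 x.1 y.1 * b x.2 y.2

theorem conditionalBasis_mem_unitaryGroup {b : Matrix β β ℂ} {a : β → Matrix α α ℂ}
    (hb : b ∈ Matrix.unitaryGroup β ℂ) (ha : ∀ k, a k ∈ Matrix.unitaryGroup α ℂ) :
    conditionalBasis b a ∈ Matrix.unitaryGroup (α × β) ℂ := by
  rw [Matrix.mem_unitaryGroup_iff', Matrix.star_eq_conjTranspose]
  ext y z
  have h : ((conditionalBasis b a)ᴴ * conditionalBasis b a) y z =
      ((a y.2)ᴴ * a z.2) y.1 z.1 * (bᴴ * b) y.2 z.2 := by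
    simp only [Matrix.mul_apply, Matrix.conjTranspose_apply, conditionalBasis, Matrix.of_apply,
      Fintype.sum_prod_type, Finset.sum_mul_sum, star_mul']
    refine Finset.sum_congr rfl fun i _ => Finset.sum_congr rfl fun k _ => ?_
    ring
  rw [h, conjTranspose_mul_self_of_mem_unitaryGroup hb]
  by_cases hk : y.2 = z.2
  · rw [hk, conjTranspose_mul_self_of_mem_unitaryGroup (ha z.2), Matrix.one_apply_eq, mul_one]
    simp [Matrix.one_apply, Prod.ext_iff, hk]
  · simp [Prod.ext_iff, hk]

theorem unitaryDiag_conditionalBasis (b : Matrix β β ℂ) (a : β → Matrix α α ℂ) (p : β → ℝ)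
    (t : β → α → ℝ) :
    unitaryDiag (conditionalBasis b a) (fun y => p y.2 * t y.2 y.1) =
      ∑ k, (p k : ℂ) • (unitaryDiag (a k) (t k) ⊗ₖ Matrix.of fun i j => b i k * star (b j k)) := by
  ext x z
  rw [unitaryDiag_apply, Matrix.sum_apply, Fintype.sum_prod_type, Finset.sum_comm]
  refine Finset.sum_congr rfl fun k _ => ?_
  rw [Matrix.smul_apply, Matrix.kroneckerMap_apply, unitaryDiag_apply, Matrix.of_apply,
    Finset.sum_mul, Finset.smul_sum]
  refine Finset.sum_congr rfl fun j _ => ?_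
  simp only [conditionalBasis, Matrix.of_apply, star_mul', smul_eq_mul]
  push_cast
  ring

theorem OrthonormalBasis.of_apply_mem_unitaryGroup
    (b : OrthonormalBasis β ℂ (EuclideanSpace ℂ β)) :
    (Matrix.of fun i k => b k i) ∈ Matrix.unitaryGroup β ℂ := by
  rw [Matrix.mem_unitaryGroup_iff', Matrix.star_eq_conjTranspose]
  ext k l
  have h := orthonormal_iff_ite.1 b.orthonormal k l
  rw [PiLp.inner_apply] at h
  rw [Matrix.mul_apply, Matrix.one_apply, ← h]
  refine Finset.sum_congr rfl fun i _ => ?_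
  simp [mul_comm]

theorem exists_orthonormalBasis_of_mem_unitaryGroup {b : Matrix β β ℂ}
    (hb : b ∈ Matrix.unitaryGroup β ℂ) :
    ∃ e : OrthonormalBasis β ℂ (EuclideanSpace ℂ β), ∀ i k, e k i = b i k := by
  have hortho : Orthonormal ℂ ((Set.univ : Set β).domRestrict fun k =>
      (WithLp.toLp 2 fun i => b i k : EuclideanSpace ℂ β)) := by
    rw [orthonormal_iff_ite]
    rintro ⟨k, -⟩ ⟨l, -⟩
    have h := congrFun (congrFun (conjTranspose_mul_self_of_mem_unitaryGroup hb) k) l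
    rw [Matrix.mul_apply, Matrix.one_apply] at h
    simp only [Subtype.mk.injEq]
    rw [← h, PiLp.inner_apply]
    refine Finset.sum_congr rfl fun i _ => ?_
    rw [Matrix.conjTranspose_apply, mul_comm]
    rfl
  obtain ⟨e, he⟩ := hortho.exists_orthonormalBasis_extension_of_card_eq (by simp)
  exact ⟨e, fun i k => by rw [he k (Set.mem_univ k)]⟩

end Bases

/-- The bases `aₖ(j) ⊗ b(k)` of a bipartite system. -/
def qcBases (S : BipartiteSystem) : Set (Op S) :=
  {U | ∃ b ∈ Matrix.unitaryGroup S.B ℂ, ∃ a : S.B → Matrix S.A S.A ℂ,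
    (∀ k, a k ∈ Matrix.unitaryGroup S.A ℂ) ∧ U = conditionalBasis b a}

theorem isCompact_qcBases (S : BipartiteSystem) : IsCompact (qcBases S) := by
  have h : qcBases S = (fun x : Matrix S.B S.B ℂ × (S.B → Matrix S.A S.A ℂ) =>
      conditionalBasis x.1 x.2) '' ((Matrix.unitaryGroup S.B ℂ : Set (Matrix S.B S.B ℂ)) ×ˢ
        Set.univ.pi fun _ => (Matrix.unitaryGroup S.A ℂ : Set (Matrix S.A S.A ℂ))) := by
    ext U
    constructor
    · rintro ⟨b, hb, a, ha, rfl⟩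
      exact ⟨(b, a), ⟨hb, fun k _ => ha k⟩, rfl⟩
    · rintro ⟨⟨b, a⟩, ⟨hb, ha⟩, rfl⟩
      exact ⟨b, hb, a, fun k => ha k (Set.mem_univ k), rfl⟩
  rw [h]
  refine IsCompact.image ((isCompact_unitaryGroup _).prod
    (isCompact_univ_pi fun _ => isCompact_unitaryGroup _)) ?_
  refine continuous_matrix fun x y => ?_
  simp only [conditionalBasis, Matrix.of_apply]
  fun_prop

theorem mem_QC_iff (S : BipartiteSystem) (ρ : Op S) : ρ ∈ QC S ↔
    ∃ U ∈ qcBases S, ∃ s : S.Idx → ℝ, (∀ i, 0 ≤ s i) ∧ ∑ i, s i = 1 ∧ ρ = unitaryDiag U s := by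
  constructor
  · rintro ⟨b, p, τ, hp, hp1, hτ, rfl⟩
    choose a ha t ht ht1 hτ' using fun k => (hτ k).exists_eq_unitaryDiag
    refine ⟨_, ⟨_, b.of_apply_mem_unitaryGroup, a, ha, rfl⟩, fun y => p y.2 * t y.2 y.1,
      fun y => mul_nonneg (hp _) (ht _ _), ?_, ?_⟩
    · rw [Fintype.sum_prod_type, Finset.sum_comm]
      simp only [← Finset.mul_sum, ht1, mul_one, hp1]
    · rw [unitaryDiag_conditionalBasis]
      refine Finset.sum_congr rfl fun k _ => ?_
      rw [hτ' k]
      rfl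
  · rintro ⟨_, ⟨b, hb, a, ha, rfl⟩, s, hs, hs1, rfl⟩
    obtain ⟨e, he⟩ := exists_orthonormalBasis_of_mem_unitaryGroup hb
    -- A conditional state must also be supplied for outcomes of probability zero. It needs some
    -- index in `S.A`, which exists because the weights sum to one.
    have hne : Nonempty S.A := by
      by_contra hA
      rw [not_nonempty_iff] at hA
      simp at hs1
    obtain ⟨i₀⟩ := hne
    set p : S.B → ℝ := fun k => ∑ j, s (j, k) with hp
    have hp0 : ∀ k, 0 ≤ p k := fun k => Finset.sum_nonneg fun j _ => hs _
    -- The conditional distribution given k, with a point mass as an arbitrary choice when `p k =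
    -- 0`.
    set t : S.B → S.A → ℝ := fun k j =>
      if p k = 0 then (if j = i₀ then 1 else 0) else s (j, k) / p k with ht
    have hst : s = fun y => p y.2 * t y.2 y.1 := by
      ext ⟨j, k⟩
      by_cases hk : p k = 0
      · have := (Finset.sum_eq_zero_iff_of_nonneg fun j _ => hs (j, k)).1 hk j (Finset.mem_univ j)
        simp [hk, this]
      · simp only [ht, if_neg hk]
        field_simp
    refine ⟨e, p, fun k => unitaryDiag (a k) (t k), hp0, ?_, fun k =>
      isState_unitaryDiag (ha k) (fun j => ?_) ?_, ?_⟩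
    · rw [← hs1, Fintype.sum_prod_type, Finset.sum_comm]
    · by_cases hk : p k = 0
      · simp only [ht, if_pos hk]
        split_ifs <;> simp
      · simp only [ht, if_neg hk]
        exact div_nonneg (hs _) (hp0 k)
    · by_cases hk : p k = 0
      · simp [ht, hk]
      · simp only [ht, if_neg hk, ← Finset.sum_div]
        exact div_self hk
    · conv_lhs => rw [hst]
      rw [unitaryDiag_conditionalBasis]
      refine Finset.sum_congr rfl fun k _ => ?_
      congr 2
      ext i j
      simp [ketbra, he]

theorem submatrix_mem_unitaryGroup {ι κ : Type} [Fintype ι] [DecidableEq ι] [Fintype κ]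
    [DecidableEq κ] {U : Matrix ι ι ℂ} (hU : U ∈ Matrix.unitaryGroup ι ℂ) (e : κ ≃ ι) :
    U.submatrix e e ∈ Matrix.unitaryGroup κ ℂ := by
  rw [Matrix.mem_unitaryGroup_iff, Matrix.star_eq_conjTranspose, Matrix.conjTranspose_submatrix,
    Matrix.submatrix_mul_equiv, mul_conjTranspose_self_of_mem_unitaryGroup hU,
    Matrix.submatrix_one_equiv]

theorem unitaryDiag_submatrix {ι κ : Type} [Fintype ι] [DecidableEq ι] [Fintype κ]
    [DecidableEq κ] (U : Matrix ι ι ℂ) (s : ι → ℝ) (e : κ ≃ ι) :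
    unitaryDiag (U.submatrix e e) (s ∘ e) = (unitaryDiag U s).submatrix e e := by
  ext i j
  rw [Matrix.submatrix_apply, unitaryDiag_apply, unitaryDiag_apply]
  exact e.sum_comp fun k => U (e i) k * s k * star (U (e j) k)

theorem isBasisFamily_QC : IsBasisFamily QC qcBases where
  unitary := by
    rintro S _ ⟨b, hb, a, ha, rfl⟩
    exact conditionalBasis_mem_unitaryGroup hb ha
  compact := isCompact_qcBases
  nonempty S := ⟨_, 1, one_mem _, fun _ => 1, fun _ => one_mem _, rfl⟩
  mem_iff := mem_QC_iff
  join_mem := by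
    rintro S m n _ ⟨b, hb, a, ha, rfl⟩ _ ⟨b', hb', a', ha', rfl⟩
    let eA : (Fin (m + n) → S.A) ≃ (Fin m → S.A) × (Fin n → S.A) := (Fin.appendEquiv m n).symm
    let eB : (Fin (m + n) → S.B) ≃ (Fin m → S.B) × (Fin n → S.B) := (Fin.appendEquiv m n).symm
    -- Regrouping the four factors, the B-bases tensor together, and the A-basis conditioned on a
    -- pair of outcomes is the tensor product of the two conditional ones.
    refine ⟨(b ⊗ₖ b').submatrix eB eB,
      submatrix_mem_unitaryGroup (Matrix.kronecker_mem_unitary hb hb') eB,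
      fun k => (a (eB k).1 ⊗ₖ a' (eB k).2).submatrix eA eA,
      fun k => submatrix_mem_unitaryGroup (Matrix.kronecker_mem_unitary (ha _) (ha' _)) eA, ?_⟩
    ext x y
    exact mul_mul_mul_comm _ _ _ _

/-- The bipartite system with the roles of the two parts interchanged. -/
def BipartiteSystem.swap (S : BipartiteSystem) : BipartiteSystem where
  A := S.B
  B := S.A

/-- The operator on the interchanged system. -/
def swapOp {S : BipartiteSystem} (X : Op S) : Op S.swap :=
  X.submatrix (Equiv.prodComm S.B S.A) (Equiv.prodComm S.B S.A)

/-- The bases `a(k) ⊗ bₖ(j)` of a bipartite system. -/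
def cqBases (S : BipartiteSystem) : Set (Op S) := {U | swapOp U ∈ qcBases S.swap}

theorem mem_CQ_iff_swapOp_mem_QC (S : BipartiteSystem) (ρ : Op S) :
    ρ ∈ CQ S ↔ swapOp ρ ∈ QC S.swap := by
  have key : ∀ (a : OrthonormalBasis S.A ℂ (EuclideanSpace ℂ S.A)) (p : S.A → ℝ)
      (τ : S.A → Matrix S.B S.B ℂ), swapOp (∑ k, (p k : ℂ) • (ketbra (a k) ⊗ₖ τ k)) =
      ∑ k, (p k : ℂ) • (τ k ⊗ₖ ketbra (a k)) := by
    intro a p τ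
    ext x y
    change (∑ k, (p k : ℂ) • (ketbra (a k) ⊗ₖ τ k)) (x.2, x.1) (y.2, y.1) = _
    rw [Matrix.sum_apply]
    refine (Finset.sum_congr rfl fun k _ => ?_).trans (Matrix.sum_apply _ _ _ _).symm
    exact congrArg ((p k : ℂ) * ·) (mul_comm _ _)
  constructor
  · rintro ⟨a, p, τ, hp, hp1, hτ, rfl⟩
    exact ⟨a, p, τ, hp, hp1, hτ, key a p τ⟩
  · rintro ⟨a, p, τ, hp, hp1, hτ, e⟩
    refine ⟨a, p, τ, hp, hp1, hτ, ?_⟩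
    have : swapOp ρ = swapOp (∑ k, (p k : ℂ) • (ketbra (a k) ⊗ₖ τ k)) := e.trans (key a p τ).symm
    exact congrArg (swapOp (S := S.swap)) this

theorem isBasisFamily_CQ : IsBasisFamily CQ cqBases where
  unitary S U hU := submatrix_mem_unitaryGroup (isBasisFamily_QC.unitary S.swap _ hU)
    (Equiv.prodComm S.A S.B)
  compact S := by
    have h : cqBases S = (fun U : Op S.swap => (swapOp U : Op S)) '' qcBases S.swap := by
      ext U
      constructor
      · exact fun hU => ⟨swapOp U, hU, rfl⟩
      · rintro ⟨V, hV, rfl⟩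
        exact hV
    rw [h]
    exact (isCompact_qcBases S.swap).image (continuous_id.matrix_submatrix _ _)
  nonempty S := by
    obtain ⟨V, hV⟩ := isBasisFamily_QC.nonempty S.swap
    exact ⟨swapOp V, hV⟩
  mem_iff S ρ := by
    rw [mem_CQ_iff_swapOp_mem_QC, isBasisFamily_QC.mem_iff]
    constructor
    · rintro ⟨V, hV, s, hs, hs1, e⟩
      refine ⟨swapOp V, hV, s ∘ Equiv.prodComm S.A S.B, fun i => hs _,
        ((Equiv.prodComm S.A S.B).sum_comp s).trans hs1, ?_⟩
      exact (congrArg (swapOp (S := S.swap)) e).trans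
        (unitaryDiag_submatrix V s (Equiv.prodComm S.A S.B)).symm
    · rintro ⟨U, hU, s, hs, hs1, rfl⟩
      exact ⟨swapOp U, hU, s ∘ Equiv.prodComm S.B S.A, fun i => hs _,
        ((Equiv.prodComm S.B S.A).sum_comp s).trans hs1,
        (unitaryDiag_submatrix U s (Equiv.prodComm S.B S.A)).symm⟩
  -- Interchanging the parties commutes definitionally with tensor powers and with `joinOp`.
  join_mem S m n U hU V hV := isBasisFamily_QC.join_mem S.swap m n (swapOp U) hU (swapOp V) hV

theorem mainTheorem4 (F : StateFamily) (hF : F = QC ∨ F = CQ) :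
    -- the minimum that defines the relative entropy of discord exists and is finite
    (∀ (S : BipartiteSystem) (φ : Op S), IsState φ →
      IsLeast (relEntropy φ '' F S) ((relDiscord F S φ : ℝ) : EReal)) ∧
    -- the continuity bound, and asymptotic continuity
    (∀ (S : BipartiteSystem) (φ ψ : Op S), IsState φ → IsState ψ →
      |relDiscord F S φ - relDiscord F S ψ| ≤
        traceNorm (φ - ψ) * Real.logb 2 S.dim + 2 * h₂ (traceNorm (φ - ψ) / 2)) ∧
    IsAsymptoticallyContinuous (relDiscord F) ∧
    -- the limit that defines the regularization exists
    (∀ (S : BipartiteSystem) (φ : Op S), IsState φ →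
      Tendsto (fun n : ℕ => relDiscord F (S.pow n) (tensorPow φ n) / n) atTop
        (𝓝 (regularization (relDiscord F) S φ))) ∧
    -- for every class of free operations, the regularization is consistent
    (∀ O : OperationClass, O.Preserves F →
      IsMonotone O (relDiscord F) ∧
      IsConsistent O (regularization (relDiscord F)) ∧
      (O.ClosedUnderTensorPowers → IsMonotone O (regularization (relDiscord F)))) := by
  obtain ⟨E, h⟩ : ∃ E, IsBasisFamily F E := by
    rcases hF with rfl | rfl
    exacts [⟨_, isBasisFamily_QC⟩, ⟨_, isBasisFamily_CQ⟩]
  exact ⟨fun _ _ hφ => h.isLeast_relDiscord hφ, fun _ _ _ hφ hψ => h.abs_relDiscord_sub_le hφ hψ,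
    h.isAsymptoticallyContinuous, fun _ _ hφ => h.tendsto_regularization hφ,
    fun _ hO => ⟨h.isMonotone hO, h.isConsistent hO, h.isMonotone_regularization hO⟩⟩
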